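/- **Setting.** Let $(M,d)$ be a complete separable metric space with its Borel $\sigma$-algebra. $B_b(M)$ is the Banach space of bounded Borel functions $M\to\mathbb C$ with the supremum norm, $C_b(M)\subset B_b(M)$ the continuous ones, $\mathcal M(M)$ the space of complex Borel measures, $\langle f,\mu\rangle=\int f\,d\mu$, $\sigma=\sigma(B_b(M),\mathcal M(M))$ the associated weak topology, $\rightharpoonup$ convergence in $\sigma$, and $\mathscr L(B_b(M),\sigma)$ the space of $\sigma$-continuous linear operators on $B_b(M)$ (these are bounded, and are exactly the operators given by bounded complex kernels). For a measure space $(S,m)$, a function $\Phi:S\to B_b(M)$ is $\mathcal M(M)$-integrable if $\langle\Phi,\mu\rangle\in L^1(m)$ for all $\mu\in\mathcal M(M)$ and for each measurable $A\subset S$ there is $x_A\in B_b(M)$ with $\langle x_A,\mu\rangle=\int_A\langle\Phi(s),\mu\rangle\,dm(s)$ for all $\mu$; then $\int_A\Phi\,dm:=x_A$. A *strong Feller semigroup* is a family $\mathscr T=(\mathscr T(t))_{t\ge0}\subset\mathscr L(B_b(M),\sigma)$ with $\mathscr T(0)=I$, $\mathscr T(t+s)=\mathscr T(t)\mathscr T(s)$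 for $s,t\ge 0$, $\mathscr T(t)B_b(M)\subset C_b(M)$ for $t>0$, and $\mathscr T(t)f\rightharpoonup f$ as $t\downarrow0$ for $f\in C_b(M)$. It is of *type* $(C,\omega)$, where $C\ge1$ and $\omega\in\mathbb R$, if $\|\mathscr T(t)\|\le Ce^{\omega t}$ for all $t\ge0$ (such $C,\omega$ always exist). Its *Laplace transform* is $\mathscr R(\lambda)f=\int_0^\infty e^{-\lambda t}\mathscr T(t)f\,dt$ for $\operatorname{Re}\lambda>\omega$ ($\mathcal M(M)$-integral), and its *full generator* is the unique multivalued operator $\mathscr L\subset B_b(M)\times B_b(M)$ with $\mathscr R(\lambda)=(\lambda-\mathscr L)^{-1}$ for $\operatorname{Re}\lambda>\omega$, that is, $(f,g)\in\mathscr L$ if and only if $\mathscr R(\lambda)(\lambda f-g)=f$. Write $D(\mathscr L)=\{f:\exists g,\ (f,g)\in\mathscr L\}$. **Theorem.** Let $\mathscr T$ be a strong Feller semigroup of type $(C,\omega)$ with full generator $\mathscr L$ and Laplace transform $\mathscr R$. Let $B:D(B)\to B_b(M)$ be a linear operator, defined on a linear subspace $D(B)\subset B_b(M)$ with $D(\mathscr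 L)\subset D(B)$, such that 1. $B\mathscr R(\lambda)\in\mathscr L(B_b(M),\sigma)$ for some $\lambda\in\mathbb C$ with $\operatorname{Re}\lambda>\omega$; 2. for every $t>0$ the map $B\mathscr T(t)$, initially defined on $D(\mathscr L)$, has an extension to an operator in $\mathscr L(B_b(M),\sigma)$, still denoted by $B\mathscr T(t)$; 3. for all $f\in B_b(M)$ and $\mu\in\mathcal M(M)$, the function $s\mapsto\langle B\mathscr T(s)f,\mu\rangle$ is measurable on $(0,\infty)$; 4. there is $\varphi\in L^1_{\mathrm{loc}}([0,\infty))$ with $\|B\mathscr T(s)\|\le\varphi(s)$ for all $s>0$. Then $\mathscr L+B=\{(f,g+Bf):(f,g)\in\mathscr L\}$ is the full generator of a strong Feller semigroup $\mathscr P=(\mathscr P(t))_{t\ge0}$ which satisfies, for all $f\in B_b(M)$ and $t\ge0$, $$\mathscr P(t)f=\mathscr T(t)f+\int_0^t\mathscr P(t-s)B\mathscr T(s)f\,ds ,$$ where the integral exists as an $\mathcal M(M)$-integral. -/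

import Mathlib

open MeasureTheory Set Filter Topology
open scoped ENNReal

noncomputable section

namespace StrongFellerPerturbation

/-- The bounded measurable functions `M → ℂ`, as a subspace of the space of all bounded functions
`M → ℂ` with the supremum norm. -/
def bddMeasurable (M : Type*) [MeasurableSpace M] : Submodule ℂ (lp (fun _ : M => ℂ) ∞) where
  carrier := {f | Measurable (fun x => f x)}
  zero_mem' := by simp
  add_mem' := fun hf hg => Measurable.add hf hg
  smul_mem' := fun c _ hf => Measurable.const_smul hf c

/-- The space `B_b(M)` with the supremum norm. -/
def Bb (M : Type*) [MeasurableSpace M] : Type _ := bddMeasurable M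

instance (M : Type*) [MeasurableSpace M] : NormedAddCommGroup (Bb M) :=
  inferInstanceAs (NormedAddCommGroup (bddMeasurable M))

instance (M : Type*) [MeasurableSpace M] : NormedSpace ℂ (Bb M) :=
  inferInstanceAs (NormedSpace ℂ (bddMeasurable M))

instance (M : Type*) [MeasurableSpace M] : CoeFun (Bb M) (fun _ => M → ℂ) where
  coe f := fun x => f.1 x

variable {M : Type*} [MeasurableSpace M]

theorem Bb.norm_le_iff (f : Bb M) {c : ℝ} (hc : 0 ≤ c) : ‖f‖ ≤ c ↔ ∀ x, ‖f x‖ ≤ c :=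
  ⟨fun h x => (lp.norm_apply_le_norm ENNReal.top_ne_zero f.1 x).trans h,
    fun h => lp.norm_le_of_forall_le hc h⟩

theorem Bb.exists_coe_eq (f : M → ℂ) :
    (∃ g : Bb M, ∀ x, g x = f x) ↔ Measurable f ∧ ∃ c, ∀ x, ‖f x‖ ≤ c := by
  constructor
  · rintro ⟨g, hg⟩
    have h : (fun x => g x) = f := funext hg
    subst h
    exact ⟨g.2, ‖g‖, fun x => lp.norm_apply_le_norm ENNReal.top_ne_zero g.1 x⟩
  · rintro ⟨hm, c, hc⟩
    have hb : Memℓp f ∞ := memℓp_infty ⟨c, by rintro _ ⟨x, rfl⟩; exact hc x⟩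
    exact ⟨⟨⟨f, hb⟩, hm⟩, fun x => rfl⟩

@[simp] theorem Bb.add_apply (f g : Bb M) (x : M) : (f + g) x = f x + g x := rfl
@[simp] theorem Bb.sub_apply (f g : Bb M) (x : M) : (f - g) x = f x - g x := rfl
@[simp] theorem Bb.neg_apply (f : Bb M) (x : M) : (-f) x = -f x := rfl
@[simp] theorem Bb.smul_apply (c : ℂ) (f : Bb M) (x : M) : (c • f) x = c * f x := rfl

@[ext] theorem Bb.ext {f g : Bb M} (h : ∀ x, f x = g x) : f = g :=
  Subtype.ext (Subtype.ext (funext h))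

/-- The duality `⟨f, μ⟩ = ∫ f dμ` between `B_b(M)` and the space `𝓜(M)` of complex measures. -/
def dual (f : Bb M) (μ : ComplexMeasure M) : ℂ :=
  VectorMeasure.integral μ (fun x => f x) (ContinuousLinearMap.mul ℝ ℂ)

/-- The weak topology `σ = σ(B_b(M), 𝓜(M))`: the coarsest one making every `⟨·, μ⟩` continuous. -/
abbrev sigma (M : Type*) [MeasurableSpace M] : TopologicalSpace (Bb M) :=
  ⨅ μ : ComplexMeasure M, TopologicalSpace.induced (fun f => dual f μ) inferInstance

/-- `T ∈ 𝓛(B_b(M), σ)`, equivalently `T` is a kernel operator. -/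
def IsSigmaContinuous (T : Bb M →L[ℂ] Bb M) : Prop :=
  @Continuous (Bb M) (Bb M) (sigma M) (sigma M) T

/-- Strong Feller semigroups on `B_b(M)`. Only the values `T t` with `0 ≤ t` are relevant. -/
structure IsStrongFellerSemigroup [TopologicalSpace M] (T : ℝ → (Bb M →L[ℂ] Bb M)) : Prop where
  sigmaContinuous : ∀ t, 0 ≤ t → IsSigmaContinuous (T t)
  map_zero : T 0 = ContinuousLinearMap.id ℂ (Bb M)
  map_add : ∀ s t, 0 ≤ s → 0 ≤ t → T (t + s) = (T t).comp (T s)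
  /-- `T t` maps `B_b(M)` into `C_b(M)` for `t > 0`. -/
  strongFeller : ∀ t, 0 < t → ∀ f : Bb M, Continuous (fun x => T t f x)
  /-- `T t f ⇀ f` as `t ↓ 0`, for `f ∈ C_b(M)`. -/
  tendsto_zero : ∀ f : Bb M, Continuous (fun x => f x) →
    Tendsto (fun t => T t f) (𝓝[>] 0) (@nhds (Bb M) (sigma M) f)

/-- `T` is of type `(C, ω)`. -/
def IsOfType (T : ℝ → (Bb M →L[ℂ] Bb M)) (C ω : ℝ) : Prop :=
  1 ≤ C ∧ ∀ t, 0 ≤ t → ‖T t‖ ≤ C * Real.exp (ω * t)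

/-- `Φ : S → B_b(M)` is `𝓜(M)`-integrable with respect to `m`, and its `𝓜(M)`-integral over the
whole space is `u`. -/
structure HasWeakIntegral {S : Type*} [MeasurableSpace S] (m : Measure S) (Φ : S → Bb M)
    (u : Bb M) : Prop where
  scalarly_integrable : ∀ μ : ComplexMeasure M, Integrable (fun s => dual (Φ s) μ) m
  exists_integral : ∀ A : Set S, MeasurableSet A →
    ∃ v : Bb M, ∀ μ : ComplexMeasure M, dual v μ = ∫ s in A, dual (Φ s) μ ∂m
  integral_eq : ∀ μ : ComplexMeasure M, dual u μ = ∫ s, dual (Φ s) μ ∂m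

/-- `u = 𝓡(z) f`, where `𝓡` is the Laplace transform of `T`: `u` is the `𝓜(M)`-integral of
`t ↦ e^{-zt} T(t) f` over `(0, ∞)`. -/
def IsLaplaceTransform (T : ℝ → (Bb M →L[ℂ] Bb M)) (z : ℂ) (f u : Bb M) : Prop :=
  HasWeakIntegral (volume.restrict (Ioi (0 : ℝ)))
    (fun t : ℝ => Complex.exp (-(z * (t : ℂ))) • T t f) u

/-- The full generator of `T`, as a multivalued operator (a subset of `B_b(M) × B_b(M)`): the
relation `𝓛` with `𝓡(z) = (z - 𝓛)⁻¹` for `Re z > ω`, `(C, ω)` being a type of `T`. Thus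
`(f, g) ∈ 𝓛` means `𝓡(z) (z f - g) = f`. -/
def fullGenerator (T : ℝ → (Bb M →L[ℂ] Bb M)) : Set (Bb M × Bb M) :=
  {p | ∃ C ω : ℝ, IsOfType T C ω ∧
    ∀ z : ℂ, ω < z.re → IsLaplaceTransform T z (z • p.1 - p.2) p.1}

/-- The domain `D(𝓛) = {f | ∃ g, (f, g) ∈ 𝓛}` of a multivalued operator. -/
def domain (L : Set (Bb M × Bb M)) : Set (Bb M) :=
  {f | ∃ g, (f, g) ∈ L}

/-- The sum `𝓛 + B = {(f, g + B f) | (f, g) ∈ 𝓛, f ∈ D(B)}`. -/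
def addOperator (L : Set (Bb M × Bb M)) (B : Bb M →ₗ.[ℂ] Bb M) : Set (Bb M × Bb M) :=
  {p | ∃ g, (p.1, g) ∈ L ∧ ∃ h : p.1 ∈ B.domain, p.2 = g + B ⟨p.1, h⟩}

end StrongFellerPerturbation

end

open StrongFellerPerturbation

/-!
Write `U * V` for the convolution of two operator families. The semigroup `𝓟` has to solve the
Volterra equation `𝓟 = 𝓣 + 𝓟 * B𝓣`. Raising the rate `ω` makes the weighted integral
`∫ e^{-ω s} ‖B𝓣(s)‖ ds` smaller than `1`, so that the Dyson–Phillips series `∑ 𝓣 * (B𝓣)^{*n}`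
converges and the solution is unique; since `t ↦ 𝓟(t + s)` and `t ↦ 𝓟(t) 𝓟(s)` solve the same
equation, uniqueness gives the semigroup law. Under the Laplace transform the equation becomes
`𝓡_𝓟 (1 - B𝓡) = 𝓡` with `‖B𝓡‖ < 1`, and this identifies the generator of `𝓟` as `𝓛 + B`.

Bounded kernel operators preserve bounded pointwise limits, and `D(𝓛)`, the range of `𝓡(λ)`, is
dense for these limits. An identity between kernel operators therefore only has to be checked
on `D(𝓛)`, which is how `B𝓣(t + s) = B𝓣(t) 𝓣(s)` and `∫₀^∞ e^{-λ t} B𝓣(t) dt = B𝓡(λ)` are obtained.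
-/

noncomputable section

namespace StrongFellerPerturbation

variable {X S : Type*} [MeasurableSpace X] [MeasurableSpace S]

/-! ### Bounded pointwise convergence -/

/-- The evaluation functional `f ↦ f x`. Pointwise computations are written with `ev` rather than
with the coercion, so that linearity and continuity in `f` come from `ContinuousLinearMap`. -/
def ev (x : X) : Bb X →L[ℂ] ℂ :=
  LinearMap.mkContinuous
    { toFun := fun f => f x
      map_add' := fun _ _ => rfl
      map_smul' := fun _ _ => rfl } 1
    (fun f => (one_mul ‖f‖).symm ▸ (Bb.norm_le_iff f (norm_nonneg f)).1 le_rfl x)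

theorem norm_ev_le (f : Bb X) (x : X) : ‖ev x f‖ ≤ ‖f‖ :=
  (Bb.norm_le_iff f (norm_nonneg f)).1 le_rfl x

theorem norm_le_of_ev {f : Bb X} {c : ℝ} (hc : 0 ≤ c) (h : ∀ x, ‖ev x f‖ ≤ c) : ‖f‖ ≤ c :=
  (Bb.norm_le_iff f hc).2 h

theorem measurable_ev (f : Bb X) : Measurable fun x => ev x f := f.2

theorem ext_ev {f g : Bb X} (h : ∀ x, ev x f = ev x g) : f = g := Bb.ext h

/-- The element of `B_b(X)` given by a bounded measurable function. -/
def Bb.mk (f : X → ℂ) (hf : Measurable f) {c : ℝ} (hc : ∀ x, ‖f x‖ ≤ c) : Bb X :=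
  ⟨⟨f, memℓp_infty ⟨c, forall_mem_range.2 hc⟩⟩, hf⟩

@[simp] theorem ev_mk {f : X → ℂ} (hf : Measurable f) {c : ℝ} (hc : ∀ x, ‖f x‖ ≤ c) (x : X) :
    ev x (Bb.mk f hf hc) = f x := rfl

instance : CompleteSpace (Bb X) := by
  have isClosed : IsClosed (bddMeasurable X : Set (lp (fun _ : X => ℂ) ∞)) := by
    refine IsSeqClosed.isClosed fun f g hf hfg => ?_
    refine measurable_of_tendsto_metrizable (f := fun n x => f n x) hf
      (tendsto_pi_nhds.2 fun x => ?_)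
    have lipschitz : LipschitzWith 1 fun h : lp (fun _ : X => ℂ) ∞ => h x :=
      LipschitzWith.of_dist_le' (K := 1) (fun a b => by
        rw [one_mul, dist_eq_norm, dist_eq_norm]
        exact lp.norm_apply_le_norm ENNReal.top_ne_zero (a - b) x) |>.weaken (by simp)
    exact (lipschitz.continuous.tendsto g).comp hfg
  exact isClosed.completeSpace_coe

open Classical in
/-- The indicator function of a measurable set. It is zero if the set is not measurable, as
required of the vector measure `A ↦ ℓ (Bb.ind A)`. -/
def Bb.ind (A : Set X) : Bb X :=
  if hA : MeasurableSet A then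
    Bb.mk (A.indicator 1) (measurable_one.indicator hA) (c := 1) fun x => by
      by_cases h : x ∈ A <;> simp [h]
  else 0

theorem ev_ind {A : Set X} (hA : MeasurableSet A) (x : X) :
    ev x (Bb.ind A) = A.indicator (1 : X → ℂ) x := by
  rw [Bb.ind, dif_pos hA, ev_mk]

theorem norm_ind_le (A : Set X) : ‖Bb.ind A‖ ≤ 1 := by
  by_cases hA : MeasurableSet A
  · refine norm_le_of_ev zero_le_one fun x => ?_
    rw [ev_ind hA]
    by_cases h : x ∈ A <;> simp [h]
  · simp [Bb.ind, hA]

/-- Bounded pointwise convergence. -/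
def BPTendsto {ι : Type*} (f : ι → Bb X) (l : Filter ι) (g : Bb X) : Prop :=
  (∃ C, ∀ᶠ i in l, ‖f i‖ ≤ C) ∧ ∀ x, Tendsto (fun i => ev x (f i)) l (𝓝 (ev x g))

/-- Sequential continuity for bounded pointwise convergence; by dominated convergence it
characterises the functionals given by a complex measure. -/
def BPContinuous (ℓ : Bb X → ℂ) : Prop :=
  ∀ (f : ℕ → Bb X) (g : Bb X), BPTendsto f atTop g → Tendsto (fun n => ℓ (f n)) atTop (𝓝 (ℓ g))

theorem BPTendsto.comp {ι κ : Type*} {f : ι → Bb X} {l : Filter ι} {g : Bb X}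
    (h : BPTendsto f l g) {k : Filter κ} {u : κ → ι} (hu : Tendsto u k l) :
    BPTendsto (fun i => f (u i)) k g :=
  ⟨h.1.imp fun _ hC => hu.eventually hC, fun x => (h.2 x).comp hu⟩

theorem BPTendsto.const_smul {ι : Type*} {f : ι → Bb X} {l : Filter ι} {g : Bb X}
    (h : BPTendsto f l g) (c : ℂ) : BPTendsto (fun i => c • f i) l (c • g) := by
  obtain ⟨C, hC⟩ := h.1
  refine ⟨⟨‖c‖ * C, hC.mono fun i hi => (norm_smul_le _ _).trans (by gcongr)⟩, fun x => ?_⟩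
  simpa only [map_smul] using (h.2 x).const_smul c

theorem BPContinuous.tendsto {ℓ : Bb X → ℂ} (hℓ : BPContinuous ℓ) {ι : Type*} {f : ι → Bb X}
    {l : Filter ι} [l.IsCountablyGenerated] {g : Bb X} (h : BPTendsto f l g) :
    Tendsto (fun i => ℓ (f i)) l (𝓝 (ℓ g)) :=
  tendsto_of_seq_tendsto fun _ hu => hℓ _ _ (h.comp hu)

theorem bpContinuous_ev (x : X) : BPContinuous (ev x) := fun _ _ h => h.2 x

theorem Bb.simpleFunc_induction {p : Bb X → Prop}
    (ind : ∀ (c : ℂ) (A : Set X), MeasurableSet A → p (c • Bb.ind A))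
    (add : ∀ f g, p f → p g → p (f + g)) (s : SimpleFunc X ℂ) {f : Bb X}
    (hf : ∀ x, ev x f = s x) : p f := by
  have bounded : ∀ s : SimpleFunc X ℂ, ∃ c, ∀ x, ‖s x‖ ≤ c := fun s =>
    (s.finite_range.image norm).bddAbove.imp fun c hc x => hc ⟨_, ⟨x, rfl⟩, rfl⟩
  induction s using SimpleFunc.induction generalizing f with
  | @const c A hA =>
    convert ind c A hA
    refine ext_ev fun x => ?_
    rw [hf, map_smul, ev_ind hA]
    by_cases h : x ∈ A <;> simp [h]
  | @add s t _ hs ht =>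
    obtain ⟨c, hc⟩ := bounded s
    obtain ⟨d, hd⟩ := bounded t
    rw [show f = Bb.mk s s.measurable hc + Bb.mk t t.measurable hd from
      ext_ev fun x => by simp [hf]]
    exact add _ _ (hs fun _ => rfl) (ht fun _ => rfl)

theorem Bb.induction_ind {p : Bb X → Prop}
    (ind : ∀ (c : ℂ) (A : Set X), MeasurableSet A → p (c • Bb.ind A))
    (add : ∀ f g, p f → p g → p (f + g))
    (lim : ∀ (f : ℕ → Bb X) g, BPTendsto f atTop g → (∀ n, p (f n)) → p g) (f : Bb X) : p f := by
  have hf := (measurable_ev f).stronglyMeasurable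
  let s := hf.approxBounded ‖f‖
  have norm_le := fun n => StronglyMeasurable.norm_approxBounded_le hf (norm_nonneg f) n
  refine lim (fun n => Bb.mk (s n) (s n).measurable (norm_le n)) f
    ⟨⟨‖f‖, .of_forall fun n => norm_le_of_ev (norm_nonneg f) (norm_le n)⟩, fun x => ?_⟩
    fun n => Bb.simpleFunc_induction ind add (s n) fun _ => rfl
  exact StronglyMeasurable.tendsto_approxBounded_of_norm_le hf (norm_ev_le f x)

theorem bpTendsto_ind_iUnion {A : ℕ → Set X} (hA : ∀ i, MeasurableSet (A i))
    (hd : Pairwise (Function.onFun Disjoint A)) :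
    BPTendsto (fun s : Finset ℕ => ∑ i ∈ s, Bb.ind (A i)) atTop (Bb.ind (⋃ i, A i)) := by
  have measurableSet : ∀ s : Finset ℕ, MeasurableSet (⋃ i ∈ s, A i) := fun s =>
    s.measurableSet_biUnion fun i _ => hA i
  have sum_eq : ∀ s : Finset ℕ, ∑ i ∈ s, Bb.ind (A i) = Bb.ind (⋃ i ∈ s, A i) := fun s =>
    ext_ev fun x => by
      rw [ev_ind (measurableSet s), map_sum,
        Finset.indicator_biUnion_apply s A fun i _ j _ hij => hd hij]
      exact Finset.sum_congr rfl fun i _ => ev_ind (hA i) x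
  simp only [sum_eq]
  refine ⟨⟨1, .of_forall fun s => norm_ind_le _⟩, fun x => ?_⟩
  simp only [ev_ind (measurableSet _), ev_ind (MeasurableSet.iUnion hA)]
  exact (tendsto_indicator_biUnion_finset A 1 x).mono_right (pure_le_nhds _)

theorem Bb.induction_piSystem {p : Bb X → Prop} {𝒮 : Set (Set X)}
    (h𝒮 : ‹MeasurableSpace X› = MeasurableSpace.generateFrom 𝒮) (hpi : IsPiSystem 𝒮)
    (univ : ∀ c : ℂ, p (c • Bb.ind univ))
    (basic : ∀ (c : ℂ), ∀ A ∈ 𝒮, p (c • Bb.ind A))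
    (add : ∀ f g, p f → p g → p (f + g))
    (lim : ∀ (f : ℕ → Bb X) g, BPTendsto f atTop g → (∀ n, p (f n)) → p g) (f : Bb X) : p f := by
  refine Bb.induction_ind (fun c A hA => ?_) add lim f
  have zero : p 0 := by simpa using univ 0
  induction A, hA using MeasurableSpace.induction_on_inter h𝒮 hpi generalizing c with
  | empty =>
    convert zero
    exact ext_ev fun x => by simp [ev_ind]
  | basic A hA => exact basic c A hA
  | compl A hA ih =>
    convert add _ _ (univ c) (ih (-c))
    refine ext_ev fun x => ?_
    simp only [map_add, map_smul, ev_ind hA, ev_ind hA.compl, ev_ind MeasurableSet.univ]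
    by_cases h : x ∈ A <;> simp [h]
  | iUnion A hd hA ih =>
    refine lim _ _ (((bpTendsto_ind_iUnion hA hd).comp tendsto_finset_range).const_smul c)
      fun n => ?_
    induction n with
    | zero => simpa using zero
    | succ n hn =>
      rw [Finset.sum_range_succ, smul_add]
      exact add _ _ hn (ih n c)

/-! ### Duality with complex measures and kernel operators -/

instance isFiniteMeasure_variation (μ : ComplexMeasure X) : IsFiniteMeasure μ.variation := by
  have variation_le : μ.variation ≤
      (ComplexMeasure.re μ).totalVariation + (ComplexMeasure.im μ).totalVariation := by
    refine VectorMeasure.variation_le_of_forall_enorm_le fun A _ => ?_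
    have enorm_le : ‖μ A‖ₑ ≤ ‖(μ A).re‖ₑ + ‖(μ A).im‖ₑ := by
      rw [← ofReal_norm, ← ofReal_norm, ← ofReal_norm,
        ← ENNReal.ofReal_add (norm_nonneg _) (norm_nonneg _)]
      exact ENNReal.ofReal_le_ofReal (Complex.norm_le_abs_re_add_abs_im _)
    exact enorm_le.trans (add_le_add (SignedMeasure.enorm_le_totalVariation (ComplexMeasure.re μ) A)
      (SignedMeasure.enorm_le_totalVariation (ComplexMeasure.im μ) A))
  have : IsFiniteMeasure ((ComplexMeasure.re μ).totalVariation +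
      (ComplexMeasure.im μ).totalVariation) := by
    unfold SignedMeasure.totalVariation
    infer_instance
  exact isFiniteMeasure_of_le _ variation_le

theorem integrable_ev (f : Bb X) (ν : Measure X) [IsFiniteMeasure ν] :
    Integrable (fun x => ev x f) ν :=
  (integrable_const ‖f‖).mono' (measurable_ev f).aestronglyMeasurable (.of_forall (norm_ev_le f))

/-- The functional `f ↦ ⟨f, μ⟩`. -/
def dualₗ (μ : ComplexMeasure X) : Bb X →ₗ[ℂ] ℂ where
  toFun f := dual f μ
  map_add' f g := VectorMeasure.integral_fun_add (integrable_ev f _) (integrable_ev g _)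
  map_smul' c _ := setToFun_smul _ (fun c A x => mul_smul c x (μ A)) c _

/-- The functional `f ↦ ∫ f dν` for a finite positive measure `ν`. -/
def integralₗ (ν : FiniteMeasure X) : Bb X →ₗ[ℂ] ℂ where
  toFun f := ∫ x, ev x f ∂(ν : Measure X)
  map_add' f g := by
    simp only [map_add]
    exact integral_add (integrable_ev f _) (integrable_ev g _)
  map_smul' c f := by
    simp only [map_smul, smul_eq_mul, integral_const_mul, RingHom.id_apply]

@[simp] theorem dualₗ_apply (μ : ComplexMeasure X) (f : Bb X) : dualₗ μ f = dual f μ := rfl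

@[simp] theorem integralₗ_apply (ν : FiniteMeasure X) (f : Bb X) :
    integralₗ ν f = ∫ x, ev x f ∂(ν : Measure X) := rfl

theorem bpTendsto_dual {ι : Type*} {f : ι → Bb X} {l : Filter ι} [l.IsCountablyGenerated]
    {g : Bb X} (h : BPTendsto f l g) (μ : ComplexMeasure X) :
    Tendsto (fun i => dual (f i) μ) l (𝓝 (dual g μ)) := by
  obtain ⟨C, hC⟩ := h.1
  exact VectorMeasure.tendsto_integral_filter_of_norm_le_const
    (.of_forall fun i => (measurable_ev (f i)).aestronglyMeasurable)
    ⟨C, hC.mono fun i hi => .of_forall fun x => (norm_ev_le _ x).trans hi⟩ (.of_forall h.2)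

theorem bpContinuous_dualₗ (μ : ComplexMeasure X) : BPContinuous (dualₗ μ) :=
  fun _ _ h => bpTendsto_dual h μ

theorem bpContinuous_integralₗ (ν : FiniteMeasure X) : BPContinuous (integralₗ ν) := by
  intro f g h
  obtain ⟨C, hC⟩ := h.1
  exact tendsto_integral_filter_of_norm_le_const
    (.of_forall fun n => (measurable_ev (f n)).aestronglyMeasurable)
    ⟨C, hC.mono fun n hn => .of_forall fun x => (norm_ev_le _ x).trans hn⟩ (.of_forall h.2)

@[simp] theorem dual_dirac (f : Bb X) (x : X) :
    dual f (VectorMeasure.dirac x (1 : ℂ)) = ev x f := by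
  change VectorMeasure.integral _ (fun x => ev x f) _ = _
  rw [VectorMeasure.integral_dirac' (measurable_ev f).stronglyMeasurable]
  simp

theorem dual_ind {A : Set X} (hA : MeasurableSet A) (μ : ComplexMeasure X) :
    dual (Bb.ind A) μ = μ A := by
  have coe_ind : (fun x => ev x (Bb.ind A)) = A.indicator fun _ => 1 := funext (ev_ind hA)
  change VectorMeasure.integral μ (fun x => ev x (Bb.ind A)) _ = _
  rw [coe_ind, VectorMeasure.integral_eq_setToFun,
    setToFun_indicator_const _ hA (measure_ne_top _ _)]
  exact one_mul _

theorem integralₗ_ind {A : Set X} (hA : MeasurableSet A) (ν : FiniteMeasure X) :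
    integralₗ ν (Bb.ind A) = (ν : Measure X).real A := by
  simp only [integralₗ_apply, ev_ind hA]
  rw [Pi.one_def, integral_indicator_const _ hA]
  simp

theorem ext_of_bpContinuous {ℓ ℓ' : Bb X →ₗ[ℂ] ℂ} (hℓ : BPContinuous ℓ) (hℓ' : BPContinuous ℓ')
    (h : ∀ A, MeasurableSet A → ℓ (Bb.ind A) = ℓ' (Bb.ind A)) : ℓ = ℓ' := by
  refine LinearMap.ext fun f => ?_
  induction f using Bb.induction_ind with
  | ind c A hA => rw [map_smul, map_smul, h A hA]
  | add f g hf hg => rw [map_add, map_add, hf, hg]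
  | lim f g hfg hf => exact tendsto_nhds_unique (hℓ f g hfg) (by simpa only [hf] using hℓ' f g hfg)

/-- The complex measure `A ↦ ℓ 1_A`. -/
def toComplexMeasure (ℓ : Bb X →ₗ[ℂ] ℂ) (hℓ : BPContinuous ℓ) : ComplexMeasure X where
  measureOf' A := ℓ (Bb.ind A)
  empty' := by
    rw [show Bb.ind (∅ : Set X) = 0 from ext_ev fun x => by simp [ev_ind], map_zero]
  not_measurable' A hA := by rw [Bb.ind, dif_neg hA, map_zero]
  m_iUnion' A hA hd := by
    have := hℓ.tendsto (bpTendsto_ind_iUnion hA hd)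
    simpa only [HasSum, SummationFilter.unconditional_filter, map_sum] using this

theorem dualₗ_toComplexMeasure (ℓ : Bb X →ₗ[ℂ] ℂ) (hℓ : BPContinuous ℓ) :
    dualₗ (toComplexMeasure ℓ hℓ) = ℓ :=
  ext_of_bpContinuous (bpContinuous_dualₗ _) hℓ fun _ hA => dual_ind hA _

theorem exists_signedMeasure_eq_sub (s : SignedMeasure X) :
    ∃ μ ν : FiniteMeasure X, ∀ A, MeasurableSet A →
      s A = (μ : Measure X).real A - (ν : Measure X).real A := by
  let j := s.toJordanDecomposition
  refine ⟨⟨j.posPart, j.posPart_finite⟩, ⟨j.negPart, j.negPart_finite⟩, fun A hA => ?_⟩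
  have h := congrArg (fun s : SignedMeasure X => s A) s.toSignedMeasure_toJordanDecomposition
  exact h.symm.trans (Measure.toSignedMeasure_sub_apply hA)

theorem exists_dualₗ_eq_sum (μ : ComplexMeasure X) :
    ∃ (c : Fin 4 → ℂ) (ν : Fin 4 → FiniteMeasure X), dualₗ μ = ∑ k, c k • integralₗ (ν k) := by
  obtain ⟨ν₁, ν₂, hre⟩ := exists_signedMeasure_eq_sub (ComplexMeasure.re μ)
  obtain ⟨ν₃, ν₄, him⟩ := exists_signedMeasure_eq_sub (ComplexMeasure.im μ)
  refine ⟨![1, -1, Complex.I, -Complex.I], ![ν₁, ν₂, ν₃, ν₄],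
    ext_of_bpContinuous (bpContinuous_dualₗ μ) (fun f g h => ?_) fun A hA => ?_⟩
  · simp only [LinearMap.sum_apply, LinearMap.smul_apply]
    exact tendsto_finsetSum _ fun k _ => (bpContinuous_integralₗ _ f g h).const_smul _
  · have re_eq : (μ A).re = _ := hre A hA
    have im_eq : (μ A).im = _ := him A hA
    rw [dualₗ_apply, dual_ind hA, ← Complex.re_add_im (μ A), re_eq, im_eq]
    simp only [Fin.sum_univ_four, Matrix.cons_val, LinearMap.add_apply, LinearMap.smul_apply,
      integralₗ_ind hA, smul_eq_mul]
    push_cast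
    ring

theorem tendsto_sigma_iff {ι : Type*} {f : ι → Bb X} {l : Filter ι} {g : Bb X} :
    Tendsto f l (@nhds (Bb X) (sigma X) g) ↔
      ∀ μ : ComplexMeasure X, Tendsto (fun i => dual (f i) μ) l (𝓝 (dual g μ)) := by
  rw [nhds_iInf, tendsto_iInf]
  refine forall_congr' fun μ => ?_
  rw [@nhds_induced, tendsto_comap_iff]
  rfl

theorem BPTendsto.tendsto_sigma {ι : Type*} {f : ι → Bb X} {l : Filter ι} [l.IsCountablyGenerated]
    {g : Bb X} (h : BPTendsto f l g) : Tendsto f l (@nhds (Bb X) (sigma X) g) :=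
  tendsto_sigma_iff.2 (bpTendsto_dual h)

theorem tendsto_ev_of_sigma {ι : Type*} {f : ι → Bb X} {l : Filter ι} {g : Bb X}
    (h : Tendsto f l (@nhds (Bb X) (sigma X) g)) (x : X) :
    Tendsto (fun i => ev x (f i)) l (𝓝 (ev x g)) := by
  simpa using tendsto_sigma_iff.1 h (VectorMeasure.dirac x 1)

/-- A bounded operator given by a kernel: since `f ↦ (A f)(x)` is sequentially continuous for
bounded pointwise convergence, it is the integral against a complex measure depending on `x`. -/
def IsKernelOperator (A : Bb X →L[ℂ] Bb X) : Prop :=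
  ∀ x, BPContinuous fun f => ev x (A f)

namespace IsKernelOperator

variable {A B : Bb X →L[ℂ] Bb X}

theorem bpTendsto (hA : IsKernelOperator A) {ι : Type*} {f : ι → Bb X} {l : Filter ι}
    [l.IsCountablyGenerated] {g : Bb X} (h : BPTendsto f l g) :
    BPTendsto (fun i => A (f i)) l (A g) := by
  refine ⟨?_, fun x => (hA x).tendsto h⟩
  obtain ⟨C, hC⟩ := h.1
  exact ⟨‖A‖ * C, hC.mono fun i hi => A.le_opNorm_of_le hi⟩

theorem exists_adjoint (hA : IsKernelOperator A) (μ : ComplexMeasure X) :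
    ∃ ν : ComplexMeasure X, ∀ f, dual f ν = dual (A f) μ := by
  let ℓ : Bb X →ₗ[ℂ] ℂ := dualₗ μ ∘ₗ A.toLinearMap
  have hℓ : BPContinuous ℓ := fun _ _ h => bpTendsto_dual (hA.bpTendsto h) μ
  exact ⟨toComplexMeasure ℓ hℓ, DFunLike.congr_fun (dualₗ_toComplexMeasure ℓ hℓ)⟩

protected theorem id : IsKernelOperator (ContinuousLinearMap.id ℂ (Bb X)) := bpContinuous_ev

protected theorem zero : IsKernelOperator (0 : Bb X →L[ℂ] Bb X) := fun x f g _ => by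
  simp only [_root_.zero_apply, map_zero, tendsto_const_nhds]

protected theorem comp (hA : IsKernelOperator A) (hB : IsKernelOperator B) :
    IsKernelOperator (A.comp B) :=
  fun x _ _ h => hA x _ _ (hB.bpTendsto h)

protected theorem sub (hA : IsKernelOperator A) (hB : IsKernelOperator B) :
    IsKernelOperator (A - B) := fun x f g h => by
  simpa using (hA x f g h).sub (hB x f g h)

protected theorem smul (hA : IsKernelOperator A) (c : ℂ) : IsKernelOperator (c • A) :=
  fun x f g h => by simpa using (hA x f g h).const_mul c

end IsKernelOperator

theorem ev_tsum_apply {ι : Type*} {A : ι → Bb X →L[ℂ] Bb X} (hA : Summable A) (f : Bb X) (x : X) :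
    ev x ((∑' i, A i) f) = ∑' i, ev x (A i f) :=
  (((ev x).comp (ContinuousLinearMap.apply ℂ (Bb X) f)).map_tsum hA)

protected theorem IsKernelOperator.tsum {ι : Type*} {A : ι → Bb X →L[ℂ] Bb X}
    (hA : ∀ i, IsKernelOperator (A i)) (hsum : Summable fun i => ‖A i‖) :
    IsKernelOperator (∑' i, A i) := by
  intro x f g h
  obtain ⟨C, hC⟩ := h.1
  simp only [ev_tsum_apply hsum.of_norm]
  exact tendsto_tsum_of_dominated_convergence (hsum.mul_right C) (fun i => hA i x f g h)
    (hC.mono fun n hn i => (norm_ev_le _ x).trans ((A i).le_opNorm_of_le hn))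

theorem isSigmaContinuous_iff {A : Bb X →L[ℂ] Bb X} :
    IsSigmaContinuous A ↔ IsKernelOperator A := by
  constructor
  · intro hA x f g h
    exact tendsto_ev_of_sigma
      ((@Continuous.tendsto _ _ (sigma X) (sigma X) _ hA g).comp h.tendsto_sigma) x
  · intro hA
    refine continuous_iInf_rng.2 fun μ => ?_
    rw [continuous_induced_rng]
    obtain ⟨ν, hν⟩ := hA.exists_adjoint μ
    rw [show (fun f => dual f μ) ∘ A = fun f => dual f ν from funext fun f => (hν f).symm]
    exact continuous_iInf_dom (i := ν) continuous_induced_dom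

/-! ### Weak integrals -/

section WeakIntegral

variable {m : Measure S} {a : S → ℝ} {Φ Ψ : S → Bb X} {u : Bb X}

theorem HasWeakIntegral.congr_ae (h : HasWeakIntegral m Φ u) (hΦΨ : Φ =ᵐ[m] Ψ) :
    HasWeakIntegral m Ψ u := by
  have dual_ae_eq : ∀ μ : ComplexMeasure X, (fun s => dual (Φ s) μ) =ᵐ[m] fun s => dual (Ψ s) μ :=
    fun μ => hΦΨ.mono fun s hs => congrArg (dual · μ) hs
  refine ⟨fun μ => (h.scalarly_integrable μ).congr (dual_ae_eq μ), fun A hA => ?_, fun μ => ?_⟩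
  · obtain ⟨v, hv⟩ := h.exists_integral A hA
    exact ⟨v, fun μ => (hv μ).trans (integral_congr_ae (ae_restrict_of_ae (dual_ae_eq μ)))⟩
  · exact (h.integral_eq μ).trans (integral_congr_ae (dual_ae_eq μ))

theorem HasWeakIntegral.ev_eq (h : HasWeakIntegral m Φ u) (x : X) :
    ev x u = ∫ s, ev x (Φ s) ∂m := by
  simpa using h.integral_eq (VectorMeasure.dirac x 1)

/-- `Φ` is jointly measurable and dominated by the integrable function `a`; such a function has
weak integrals, which are computed pointwise. -/
structure IsDominated (m : Measure S) (a : S → ℝ) (Φ : S → Bb X) : Prop where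
  measurable : Measurable fun p : S × X => ev p.2 (Φ p.1)
  integrable_bound : Integrable a m
  norm_le : ∀ s, ‖Φ s‖ ≤ a s

namespace IsDominated

theorem norm_ev_le (h : IsDominated m a Φ) (x : X) (s : S) : ‖ev x (Φ s)‖ ≤ a s :=
  (StrongFellerPerturbation.norm_ev_le _ x).trans (h.norm_le s)

protected theorem integrable_ev (h : IsDominated m a Φ) (x : X) :
    Integrable (fun s => ev x (Φ s)) m :=
  h.integrable_bound.mono' (h.measurable.comp measurable_prodMk_right).aestronglyMeasurable
    (.of_forall (h.norm_ev_le x))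

protected theorem restrict (h : IsDominated m a Φ) (A : Set S) : IsDominated (m.restrict A) a Φ :=
  ⟨h.measurable, h.integrable_bound.restrict, h.norm_le⟩

theorem norm_integral_ev_le (h : IsDominated m a Φ) (x : X) :
    ‖∫ s, ev x (Φ s) ∂m‖ ≤ ∫ s, a s ∂m :=
  norm_integral_le_of_norm_le h.integrable_bound (.of_forall (h.norm_ev_le x))

theorem measurable_integral_ev [SFinite m] (h : IsDominated m a Φ) :
    Measurable fun x => ∫ s, ev x (Φ s) ∂m :=
  (StronglyMeasurable.integral_prod_left (f := fun s x => ev x (Φ s))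
    h.measurable.stronglyMeasurable).measurable

theorem integrable_prod (h : IsDominated m a Φ) (ν : FiniteMeasure X) :
    Integrable (Function.uncurry fun s x => ev x (Φ s)) (m.prod (ν : Measure X)) :=
  (h.integrable_bound.comp_fst _).mono' h.measurable.aestronglyMeasurable
    (.of_forall fun p => h.norm_ev_le p.2 p.1)

theorem integrable_integralₗ (h : IsDominated m a Φ) (ν : FiniteMeasure X) :
    Integrable (fun s => integralₗ ν (Φ s)) m :=
  (h.integrable_prod ν).integral_prod_left

theorem integrable_dual (h : IsDominated m a Φ) (μ : ComplexMeasure X) :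
    Integrable (fun s => dual (Φ s) μ) m := by
  obtain ⟨c, ν, hμ⟩ := exists_dualₗ_eq_sum μ
  simp only [← dualₗ_apply, hμ, LinearMap.sum_apply, LinearMap.smul_apply]
  exact integrable_finsetSum _ fun k _ => (h.integrable_integralₗ (ν k)).smul (c k)

variable [SFinite m]

theorem dual_integral (h : IsDominated m a Φ) (hu : ∀ x, ev x u = ∫ s, ev x (Φ s) ∂m)
    (μ : ComplexMeasure X) : dual u μ = ∫ s, dual (Φ s) μ ∂m := by
  obtain ⟨c, ν, hμ⟩ := exists_dualₗ_eq_sum μ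
  simp only [← dualₗ_apply, hμ, LinearMap.sum_apply, LinearMap.smul_apply, integralₗ_apply]
  have integrable := fun k => (h.integrable_integralₗ (ν k)).smul (c k)
  simp only [Pi.smul_def, integralₗ_apply] at integrable
  rw [integral_finsetSum _ fun k _ => integrable k]
  refine Finset.sum_congr rfl fun k _ => ?_
  simp only [hu, integral_smul]
  rw [integral_integral_swap (h.integrable_prod (ν k))]

theorem hasWeakIntegral (h : IsDominated m a Φ) (hu : ∀ x, ev x u = ∫ s, ev x (Φ s) ∂m) :
    HasWeakIntegral m Φ u where
  scalarly_integrable := h.integrable_dual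
  exists_integral A _ :=
    ⟨Bb.mk _ (h.restrict A).measurable_integral_ev (h.restrict A).norm_integral_ev_le,
      (h.restrict A).dual_integral fun _ => rfl⟩
  integral_eq := h.dual_integral hu

end IsDominated

theorem IsKernelOperator.ev_integral [SFinite m] {A : Bb X →L[ℂ] Bb X} (hA : IsKernelOperator A)
    (h : IsDominated m a Φ) (hu : ∀ x, ev x u = ∫ s, ev x (Φ s) ∂m) (x : X) :
    ev x (A u) = ∫ s, ev x (A (Φ s)) ∂m := by
  obtain ⟨ν, hν⟩ := hA.exists_adjoint (VectorMeasure.dirac x 1)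
  simpa [hν] using h.dual_integral hu ν

end WeakIntegral

/-! ### Measurable families of kernel operators -/

/-- A measurable family of kernel operators. -/
structure IsKernelFamily (A : S → Bb X →L[ℂ] Bb X) : Prop where
  kernel : ∀ s, IsKernelOperator (A s)
  measurable : ∀ f, Measurable fun p : S × X => ev p.2 (A p.1 f)

section KernelFamily

variable {Z : Type*} [MeasurableSpace Z] {m : Measure S} {A : S → Bb X →L[ℂ] Bb X}

/-- The function `g(z, ·)`, for a bounded measurable function `g` on a product. -/
def sectionAt (g : Bb (Z × X)) (z : Z) : Bb X :=
  Bb.mk (fun x => ev (z, x) g) ((measurable_ev g).comp measurable_prodMk_left)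
    fun x => norm_ev_le g (z, x)

@[simp] theorem ev_sectionAt (g : Bb (Z × X)) (z : Z) (x : X) :
    ev x (sectionAt g z) = ev (z, x) g := rfl

theorem sectionAt_add (f g : Bb (Z × X)) (z : Z) :
    sectionAt (f + g) z = sectionAt f z + sectionAt g z := rfl

theorem sectionAt_smul_ind_prod (c : ℂ) {s : Set Z} {t : Set X} (hs : MeasurableSet s)
    (ht : MeasurableSet t) (z : Z) :
    sectionAt (c • Bb.ind (s ×ˢ t)) z = s.indicator (1 : Z → ℂ) z • c • Bb.ind t := by
  refine ext_ev fun x => ?_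
  simp only [ev_sectionAt, map_smul, ev_ind ht, ev_ind (hs.prod ht)]
  by_cases hz : z ∈ s <;> by_cases hx : x ∈ t <;> simp [hz, hx]

theorem BPTendsto.sectionAt {ι : Type*} {f : ι → Bb (Z × X)} {l : Filter ι} {g : Bb (Z × X)}
    (h : BPTendsto f l g) (z : Z) :
    BPTendsto (fun i => sectionAt (f i) z) l (sectionAt g z) := by
  obtain ⟨C, hC⟩ := h.1
  exact ⟨⟨C, hC.mono fun i hi => norm_le_of_ev ((norm_nonneg _).trans hi) fun x =>
    (norm_ev_le (f i) (z, x)).trans hi⟩, fun x => h.2 (z, x)⟩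

namespace IsKernelFamily

theorem measurable_sectionAt (hA : IsKernelFamily A) (g : Bb (Z × X)) :
    Measurable fun q : (S × X) × Z => ev q.1.2 (A q.1.1 (sectionAt g q.2)) := by
  have rectangle : ∀ (c : ℂ) (s : Set Z) (t : Set X), MeasurableSet s → MeasurableSet t →
      Measurable fun q : (S × X) × Z =>
        ev q.1.2 (A q.1.1 (sectionAt (c • Bb.ind (s ×ˢ t)) q.2)) := by
    intro c s t hs ht
    simp only [sectionAt_smul_ind_prod c hs ht, map_smul (A _) (s.indicator (1 : Z → ℂ) _),
      map_smul (ev _) (s.indicator (1 : Z → ℂ) _), smul_eq_mul]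
    exact ((measurable_one.indicator hs).comp measurable_snd).mul
      ((hA.measurable (c • Bb.ind t)).comp measurable_fst)
  induction g using Bb.induction_piSystem generateFrom_prod.symm isPiSystem_prod with
  | univ c => simpa using rectangle c univ univ .univ .univ
  | basic c _ h =>
    obtain ⟨s, hs, t, ht, rfl⟩ := h
    exact rectangle c s t hs ht
  | add f g hf hg =>
    simp only [sectionAt_add, map_add]
    exact hf.add hg
  | lim f g hfg hf =>
    exact measurable_of_tendsto_metrizable hf (tendsto_pi_nhds.2 fun q =>
      hA.kernel q.1.1 q.1.2 _ _ (hfg.sectionAt q.2))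

theorem measurable_apply (hA : IsKernelFamily A) {G : Z → Bb X}
    (hG : Measurable fun p : Z × X => ev p.2 (G p.1)) {σ : Z → S} (hσ : Measurable σ) :
    Measurable fun p : Z × X => ev p.2 (A (σ p.1) (G p.1)) := by
  let g (p : Z × X) : ℂ := ev p.2 (G p.1)
  let truncation (n : ℕ) : Bb (Z × X) :=
    Bb.mk ({p | ‖g p‖ ≤ n}.indicator g)
      (hG.indicator (measurableSet_le hG.norm measurable_const)) (c := n) fun p => by
        by_cases hp : ‖g p‖ ≤ n <;> simp [indicator, hp]
  have bpTendsto : ∀ z, BPTendsto (fun n => sectionAt (truncation n) z) atTop (G z) := by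
    refine fun z => ⟨⟨‖G z‖, .of_forall fun n => norm_le_of_ev (norm_nonneg _) fun x => ?_⟩,
      fun x => tendsto_const_nhds.congr' ?_⟩
    · exact (norm_indicator_le_norm_self g (z, x)).trans (norm_ev_le _ x)
    · obtain ⟨N, hN⟩ := exists_nat_ge ‖ev x (G z)‖
      filter_upwards [eventually_ge_atTop N] with n hn
      exact (indicator_of_mem (a := (z, x)) (hN.trans (Nat.cast_le.2 hn)) g).symm
  refine measurable_of_tendsto_metrizable (fun n => ?_) (tendsto_pi_nhds.2 fun p =>
    hA.kernel (σ p.1) p.2 _ _ (bpTendsto p.1))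
  exact (hA.measurable_sectionAt (truncation n)).comp
    (((hσ.comp measurable_fst).prodMk measurable_snd).prodMk measurable_fst)

protected theorem comp (hA : IsKernelFamily A) {B : Z → Bb X →L[ℂ] Bb X} (hB : IsKernelFamily B)
    {W : Type*} [MeasurableSpace W] {σ : W → S} {τ : W → Z} (hσ : Measurable σ)
    (hτ : Measurable τ) : IsKernelFamily fun w => (A (σ w)).comp (B (τ w)) :=
  ⟨fun _ => (hA.kernel _).comp (hB.kernel _), fun f =>
    hA.measurable_apply (G := fun w => B (τ w) f)
      ((hB.measurable f).comp ((hτ.comp measurable_fst).prodMk measurable_snd)) hσ⟩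

protected theorem smul (hA : IsKernelFamily A) {c : S → ℂ} (hc : Measurable c) :
    IsKernelFamily fun s => c s • A s :=
  ⟨fun s => (hA.kernel s).smul _, fun f => by
    simp only [_root_.smul_apply, map_smul, smul_eq_mul]
    exact (hc.comp measurable_fst).mul (hA.measurable f)⟩

protected theorem sub (hA : IsKernelFamily A) {B : S → Bb X →L[ℂ] Bb X} (hB : IsKernelFamily B) :
    IsKernelFamily fun s => A s - B s :=
  ⟨fun s => (hA.kernel s).sub (hB.kernel s), fun f => by
    simp only [_root_.sub_apply, map_sub]
    exact (hA.measurable f).sub (hB.measurable f)⟩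

protected theorem tsum {A : ℕ → S → Bb X →L[ℂ] Bb X} (hA : ∀ n, IsKernelFamily (A n))
    (hsum : ∀ s, Summable fun n => ‖A n s‖) : IsKernelFamily fun s => ∑' n, A n s := by
  refine ⟨fun s => .tsum (fun n => (hA n).kernel s) (hsum s), fun f => ?_⟩
  simp only [ev_tsum_apply (hsum _).of_norm]
  exact .tsum fun n => (hA n).measurable f

end IsKernelFamily

open Classical in
/-- The operator `f ↦ ∫ A(s) f dm(s)` (zero if it does not exist). -/
def opIntegral (m : Measure S) (A : S → Bb X →L[ℂ] Bb X) : Bb X →L[ℂ] Bb X :=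
  if h : ∃ W : Bb X →L[ℂ] Bb X, ∀ f x, ev x (W f) = ∫ s, ev x (A s f) ∂m then h.choose else 0

theorem opIntegral_eq {W : Bb X →L[ℂ] Bb X} (hW : ∀ f x, ev x (W f) = ∫ s, ev x (A s f) ∂m) :
    opIntegral m A = W := by
  have exists_operator : ∃ W : Bb X →L[ℂ] Bb X, ∀ f x, ev x (W f) = ∫ s, ev x (A s f) ∂m :=
    ⟨W, hW⟩
  rw [opIntegral, dif_pos exists_operator]
  exact ContinuousLinearMap.ext fun f => ext_ev fun x =>
    (exists_operator.choose_spec f x).trans (hW f x).symm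

/-- A kernel family dominated in norm by the integrable function `a`. -/
structure IsDominatedFamily (m : Measure S) (a : S → ℝ) (A : S → Bb X →L[ℂ] Bb X) : Prop where
  family : IsKernelFamily A
  integrable_bound : Integrable a m
  norm_le : ∀ s, ‖A s‖ ≤ a s

namespace IsDominatedFamily

variable {a : S → ℝ}

protected theorem apply (h : IsDominatedFamily m a A) (f : Bb X) :
    IsDominated m (fun s => a s * ‖f‖) fun s => A s f :=
  ⟨h.family.measurable f, h.integrable_bound.mul_const _, fun s =>
    (A s).le_of_opNorm_le (h.norm_le s) f⟩

theorem integral_nonneg (h : IsDominatedFamily m a A) : 0 ≤ ∫ s, a s ∂m :=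
  MeasureTheory.integral_nonneg fun s => (norm_nonneg _).trans (h.norm_le s)

variable [SFinite m]

theorem ev_opIntegral (h : IsDominatedFamily m a A) (f : Bb X) (x : X) :
    ev x (opIntegral m A f) = ∫ s, ev x (A s f) ∂m := by
  let W (f : Bb X) : Bb X :=
    Bb.mk _ (h.apply f).measurable_integral_ev (h.apply f).norm_integral_ev_le
  let W' : Bb X →L[ℂ] Bb X := LinearMap.mkContinuous
    { toFun := W
      map_add' f g := ext_ev fun x => by
        simp only [W, ev_mk, map_add]
        exact integral_add ((h.apply f).integrable_ev x) ((h.apply g).integrable_ev x)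
      map_smul' c f := ext_ev fun x => by
        simp only [W, ev_mk, map_smul, integral_smul, RingHom.id_apply] }
    (∫ s, a s ∂m) fun f => norm_le_of_ev (mul_nonneg h.integral_nonneg (norm_nonneg f)) fun x => by
      rw [← integral_mul_const]
      exact (h.apply f).norm_integral_ev_le x
  rw [opIntegral_eq (W := W') fun _ _ => rfl]
  rfl

theorem norm_opIntegral_le (h : IsDominatedFamily m a A) : ‖opIntegral m A‖ ≤ ∫ s, a s ∂m :=
  (opIntegral m A).opNorm_le_bound h.integral_nonneg fun f =>
    norm_le_of_ev (mul_nonneg h.integral_nonneg (norm_nonneg f)) fun x => by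
      rw [h.ev_opIntegral, ← integral_mul_const]
      exact (h.apply f).norm_integral_ev_le x

theorem isKernelOperator_opIntegral (h : IsDominatedFamily m a A) :
    IsKernelOperator (opIntegral m A) := by
  intro x f g hfg
  obtain ⟨C, hC⟩ := hfg.1
  simp only [h.ev_opIntegral]
  refine tendsto_integral_filter_of_dominated_convergence (fun s => a s * C)
    (.of_forall fun n => ((h.apply (f n)).integrable_ev x).aestronglyMeasurable)
    (hC.mono fun n hn => .of_forall fun s => ?_) (h.integrable_bound.mul_const C)
    (.of_forall fun s => h.family.kernel s x f g hfg)
  exact (norm_ev_le _ x).trans ((A s).le_of_opNorm_le_of_le (h.norm_le s) hn)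

theorem comp_opIntegral (h : IsDominatedFamily m a A) {B : Bb X →L[ℂ] Bb X}
    (hB : IsKernelOperator B) :
    B.comp (opIntegral m A) = opIntegral m fun s => B.comp (A s) :=
  (opIntegral_eq fun f x => hB.ev_integral (h.apply f) (h.ev_opIntegral f) x).symm

theorem opIntegral_comp (h : IsDominatedFamily m a A) (B : Bb X →L[ℂ] Bb X) :
    (opIntegral m A).comp B = opIntegral m fun s => (A s).comp B :=
  (opIntegral_eq fun f x => h.ev_opIntegral (B f) x).symm

theorem opIntegral_sub (hA : IsDominatedFamily m a A) {B : S → Bb X →L[ℂ] Bb X} {b : S → ℝ}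
    (hB : IsDominatedFamily m b B) :
    opIntegral m (fun s => A s - B s) = opIntegral m A - opIntegral m B := by
  refine opIntegral_eq fun f x => ?_
  simp only [_root_.sub_apply, map_sub, hA.ev_opIntegral, hB.ev_opIntegral]
  exact (integral_sub ((hA.apply f).integrable_ev x) ((hB.apply f).integrable_ev x)).symm

end IsDominatedFamily

protected theorem IsKernelFamily.opIntegral [SFinite m] {A : Z → S → Bb X →L[ℂ] Bb X}
    {a : Z → S → ℝ}
    (hA : IsKernelFamily fun p : Z × S => A p.1 p.2)
    (h : ∀ z, IsDominatedFamily m (a z) (A z)) : IsKernelFamily fun z => opIntegral m (A z) := by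
  refine ⟨fun z => (h z).isKernelOperator_opIntegral, fun f => ?_⟩
  simp only [(h _).ev_opIntegral]
  have measurable : Measurable fun q : (Z × X) × S => ev q.1.2 (A q.1.1 q.2 f) :=
    (hA.measurable f).comp (by fun_prop : Measurable fun q : (Z × X) × S => ((q.1.1, q.2), q.1.2))
  exact measurable.stronglyMeasurable.integral_prod_right'.measurable

end KernelFamily

/-! ### Laplace transforms and convolutions -/

section Convolution

/-- An exponentially bounded kernel family on `(0, ∞)`, extended by zero to `ℝ`. -/
structure IsExpBounded (U : ℝ → Bb X →L[ℂ] Bb X) (c ω : ℝ) : Prop where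
  family : IsKernelFamily U
  eq_zero : ∀ t ≤ 0, U t = 0
  norm_le : ∀ t, ‖U t‖ ≤ c * Real.exp (ω * t)

/-- A kernel family on `(0, ∞)`, extended by zero to `ℝ`, whose norm is integrable with respect to
the weight `e^{-ωs}`, the weighted norm being dominated by `ψ`. -/
structure IsExpIntegrable (U : ℝ → Bb X →L[ℂ] Bb X) (ψ : ℝ → ℝ) (ω : ℝ) : Prop where
  family : IsKernelFamily U
  eq_zero : ∀ s ≤ 0, U s = 0
  integrable : Integrable ψ
  norm_le : ∀ s, ‖U s‖ ≤ Real.exp (ω * s) * ψ s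

/-- The restriction of a family to `(0, ∞)`, extended by zero. -/
def causal (U : ℝ → Bb X →L[ℂ] Bb X) : ℝ → Bb X →L[ℂ] Bb X := (Ioi 0).indicator U

/-- The Laplace transform `∫ e^{-zs} U(s) ds`. -/
def laplace (U : ℝ → Bb X →L[ℂ] Bb X) (z : ℂ) : Bb X →L[ℂ] Bb X :=
  opIntegral volume fun s : ℝ => Complex.exp (-(z * s)) • U s

/-- The convolution `(U * V)(t) = ∫ U(t - s) V(s) ds`. -/
def convolution (U V : ℝ → Bb X →L[ℂ] Bb X) (t : ℝ) : Bb X →L[ℂ] Bb X :=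
  opIntegral volume fun s => (U (t - s)).comp (V s)

variable {U V : ℝ → Bb X →L[ℂ] Bb X} {c d ω ω' t : ℝ} {ψ : ℝ → ℝ} {z : ℂ}

theorem causal_of_pos (U : ℝ → Bb X →L[ℂ] Bb X) (ht : 0 < t) : causal U t = U t :=
  indicator_of_mem (mem_Ioi.2 ht) U

theorem causal_of_nonpos (U : ℝ → Bb X →L[ℂ] Bb X) (ht : t ≤ 0) : causal U t = 0 :=
  indicator_of_notMem (notMem_Ioi.2 ht) U

theorem causal_add (h : ∀ t s, 0 < t → 0 < s → U (t + s) = (U t).comp (V s)) (t s : ℝ) (ht : 0 < t)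
    (hs : 0 < s) : causal U (t + s) = (causal U t).comp (causal V s) := by
  rw [causal_of_pos U ht, causal_of_pos V hs, causal_of_pos U (add_pos ht hs), h t s ht hs]

theorem norm_exp_neg_mul (z : ℂ) (s : ℝ) : ‖Complex.exp (-(z * s))‖ = Real.exp (-(z.re * s)) := by
  rw [Complex.norm_exp, Complex.neg_re, Complex.re_mul_ofReal]

theorem laplace_exp_smul (U : ℝ → Bb X →L[ℂ] Bb X) (a z : ℂ) :
    laplace (fun s : ℝ => Complex.exp (a * s) • U s) z = laplace U (z - a) := by
  have exponent : ∀ s : ℝ, -(z * s) + a * s = -((z - a) * s) := fun s => by ring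
  simp only [laplace, smul_smul, ← Complex.exp_add, exponent]

namespace IsExpIntegrable

theorem nonneg (hU : IsExpIntegrable U ψ ω) (s : ℝ) : 0 ≤ ψ s :=
  nonneg_of_mul_nonneg_right ((norm_nonneg _).trans (hU.norm_le s)) (Real.exp_pos _)

theorem isDominatedFamily (hU : IsExpIntegrable U ψ ω) (hz : ω ≤ z.re) :
    IsDominatedFamily volume ψ fun s : ℝ => Complex.exp (-(z * s)) • U s := by
  refine ⟨hU.family.smul (by fun_prop), hU.integrable, fun s => ?_⟩
  rcases le_or_gt s 0 with hs | hs
  · rw [hU.eq_zero s hs, smul_zero, norm_zero]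
    exact hU.nonneg s
  · calc ‖Complex.exp (-(z * s)) • U s‖ = Real.exp (-(z.re * s)) * ‖U s‖ := by
          rw [norm_smul, norm_exp_neg_mul]
      _ ≤ Real.exp (-(z.re * s)) * (Real.exp (ω * s) * ψ s) := by gcongr; exact hU.norm_le s
      _ ≤ Real.exp (-(z.re * s)) * (Real.exp (z.re * s) * ψ s) := by
          have := hU.nonneg s
          gcongr
      _ = ψ s := by rw [← mul_assoc, ← Real.exp_add, neg_add_cancel, Real.exp_zero, one_mul]

theorem ev_laplace (hU : IsExpIntegrable U ψ ω) (hz : ω ≤ z.re) (f : Bb X) (x : X) :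
    ev x (laplace U z f) = ∫ s : ℝ, ev x ((Complex.exp (-(z * s)) • U s) f) :=
  (hU.isDominatedFamily hz).ev_opIntegral f x

theorem comp_laplace (hU : IsExpIntegrable U ψ ω) (hz : ω ≤ z.re) {A : Bb X →L[ℂ] Bb X}
    (hA : IsKernelOperator A) : A.comp (laplace U z) = laplace (fun s => A.comp (U s)) z := by
  simp only [laplace, ← ContinuousLinearMap.comp_smul]
  exact (hU.isDominatedFamily hz).comp_opIntegral hA

theorem laplace_comp (hU : IsExpIntegrable U ψ ω) (hz : ω ≤ z.re) (A : Bb X →L[ℂ] Bb X) :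
    (laplace U z).comp A = laplace (fun s => (U s).comp A) z := by
  simp only [laplace, ← ContinuousLinearMap.smul_comp]
  exact (hU.isDominatedFamily hz).opIntegral_comp A

theorem laplace_sub (hU : IsExpIntegrable U ψ ω) {χ : ℝ → ℝ} (hV : IsExpIntegrable V χ ω)
    (hz : ω ≤ z.re) : laplace (fun s => U s - V s) z = laplace U z - laplace V z := by
  simp only [laplace, smul_sub]
  exact (hU.isDominatedFamily hz).opIntegral_sub (hV.isDominatedFamily hz)

theorem norm_laplace_le (hU : IsExpIntegrable U ψ ω) (hz : ω ≤ z.re) :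
    ‖laplace U z‖ ≤ ∫ s, ψ s :=
  (hU.isDominatedFamily hz).norm_opIntegral_le

theorem isKernelOperator_laplace (hU : IsExpIntegrable U ψ ω) (hz : ω ≤ z.re) :
    IsKernelOperator (laplace U z) :=
  (hU.isDominatedFamily hz).isKernelOperator_opIntegral

end IsExpIntegrable

namespace IsExpBounded

theorem nonneg (hU : IsExpBounded U c ω) : 0 ≤ c := by
  simpa using (norm_nonneg _).trans (hU.norm_le 0)

protected theorem sub (hU : IsExpBounded U c ω) (hV : IsExpBounded V d ω) :
    IsExpBounded (fun t => U t - V t) (c + d) ω where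
  family := hU.family.sub hV.family
  eq_zero t ht := by rw [hU.eq_zero t ht, hV.eq_zero t ht, sub_zero]
  norm_le t := (norm_sub_le _ _).trans
    ((add_le_add (hU.norm_le t) (hV.norm_le t)).trans_eq (add_mul _ _ _).symm)

theorem comp_left (hU : IsExpBounded U c ω) {A : Bb X →L[ℂ] Bb X} (hA : IsKernelOperator A) :
    IsExpBounded (fun t => A.comp (U t)) (‖A‖ * c) ω where
  family := IsKernelFamily.comp (A := fun _ : Unit => A) (σ := fun _ => ())
    ⟨fun _ => hA, fun f => (measurable_ev (A f)).comp measurable_snd⟩ hU.family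
    measurable_const measurable_id
  eq_zero t ht := by rw [hU.eq_zero t ht, ContinuousLinearMap.comp_zero]
  norm_le t := (A.opNorm_comp_le _).trans (by rw [mul_assoc]; gcongr; exact hU.norm_le t)

theorem exp_smul (hU : IsExpBounded U c ω) (a : ℂ) :
    IsExpBounded (fun t : ℝ => Complex.exp (a * t) • U t) c (ω + a.re) where
  family := hU.family.smul (by fun_prop)
  eq_zero t ht := by rw [hU.eq_zero t ht, smul_zero]
  norm_le t := by
    rw [norm_smul, Complex.norm_exp, Complex.re_mul_ofReal, add_mul, Real.exp_add, ← mul_assoc,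
      mul_comm]
    gcongr
    exact hU.norm_le t

theorem isExpIntegrable (hU : IsExpBounded U c ω) (hω : ω < ω') :
    IsExpIntegrable U ((Ioi 0).indicator fun s => c * Real.exp (-(ω' - ω) * s)) ω' where
  family := hU.family
  eq_zero := hU.eq_zero
  integrable := (integrable_indicator_iff measurableSet_Ioi).2
    ((exp_neg_integrableOn_Ioi 0 (sub_pos.2 hω)).const_mul c)
  norm_le s := by
    rcases le_or_gt s 0 with hs | hs
    · rw [hU.eq_zero s hs, norm_zero, indicator_of_notMem (notMem_Ioi.2 hs), mul_zero]
    · rw [indicator_of_mem (mem_Ioi.2 hs), mul_left_comm, ← Real.exp_add]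
      ring_nf
      simpa only [mul_comm s] using hU.norm_le s

theorem isDominatedFamily_convolution (hU : IsExpBounded U c ω) (hV : IsExpIntegrable V ψ ω)
    (t : ℝ) :
    IsDominatedFamily volume (fun s => c * Real.exp (ω * t) * ψ s) fun s => (U (t - s)).comp (V s)
    where
  family := hU.family.comp hV.family (by fun_prop) measurable_id
  integrable_bound := hV.integrable.const_mul _
  norm_le s := calc
    ‖(U (t - s)).comp (V s)‖ ≤ ‖U (t - s)‖ * ‖V s‖ := ContinuousLinearMap.opNorm_comp_le _ _
    _ ≤ c * Real.exp (ω * (t - s)) * (Real.exp (ω * s) * ψ s) := by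
      have := hU.nonneg
      gcongr
      exacts [hU.norm_le _, hV.norm_le s]
    _ = c * Real.exp (ω * t) * ψ s := by
      rw [mul_assoc, ← mul_assoc (Real.exp _), ← Real.exp_add, mul_assoc]
      ring_nf

theorem ev_convolution (hU : IsExpBounded U c ω) (hV : IsExpIntegrable V ψ ω) (t : ℝ) (f : Bb X)
    (x : X) : ev x (convolution U V t f) = ∫ s, ev x (U (t - s) (V s f)) :=
  (hU.isDominatedFamily_convolution hV t).ev_opIntegral f x

protected theorem convolution (hU : IsExpBounded U c ω) (hV : IsExpIntegrable V ψ ω) :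
    IsExpBounded (convolution U V) (c * ∫ s, ψ s) ω where
  family := IsKernelFamily.opIntegral
    (hU.family.comp hV.family (by fun_prop) measurable_snd) (hU.isDominatedFamily_convolution hV)
  eq_zero t ht := by
    refine ContinuousLinearMap.ext fun f => ext_ev fun x => ?_
    rw [hU.ev_convolution hV, _root_.zero_apply, map_zero]
    refine integral_eq_zero_of_ae (.of_forall fun s => ?_)
    rcases le_or_gt s 0 with hs | hs
    · simp [hV.eq_zero s hs]
    · simp [hU.eq_zero (t - s) (by linarith)]
  norm_le t := (hU.isDominatedFamily_convolution hV t).norm_opIntegral_le.trans_eq (by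
    rw [integral_const_mul]
    ring)

theorem convolution_sub (hU : IsExpBounded U c ω) (hV : IsExpBounded V d ω)
    {W : ℝ → Bb X →L[ℂ] Bb X} (hW : IsExpIntegrable W ψ ω) (t : ℝ) :
    convolution (fun t => U t - V t) W t = convolution U W t - convolution V W t := by
  simp only [convolution, ContinuousLinearMap.sub_comp]
  exact (hU.isDominatedFamily_convolution hW t).opIntegral_sub
    (hV.isDominatedFamily_convolution hW t)

theorem comp_convolution (hU : IsExpBounded U c ω) (hV : IsExpIntegrable V ψ ω)
    {A : Bb X →L[ℂ] Bb X} (hA : IsKernelOperator A) (t : ℝ) :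
    A.comp (convolution U V t) = convolution (fun t => A.comp (U t)) V t :=
  (hU.isDominatedFamily_convolution hV t).comp_opIntegral hA

end IsExpBounded

theorem IsDominatedFamily.integrable_convolution {a b : ℝ → ℝ} (hU : IsDominatedFamily volume a U)
    (hV : IsDominatedFamily volume b V) (f : Bb X) (x : X) :
    Integrable (Function.uncurry fun t s : ℝ => ev x (U (t - s) (V s f))) (volume.prod volume) := by
  have measurable : Measurable (Function.uncurry fun t s : ℝ => ev x (U (t - s) (V s f))) :=
    ((hU.family.comp hV.family (σ := fun p : ℝ × ℝ => p.1 - p.2) (by fun_prop)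
      measurable_snd).measurable f).comp (measurable_prodMk_right (y := x))
  refine ((Integrable.convolution_integrand (ContinuousLinearMap.mul ℝ ℝ) hV.integrable_bound
    hU.integrable_bound).mul_const ‖f‖).mono' measurable.aestronglyMeasurable
    (.of_forall fun ⟨t, s⟩ => (norm_ev_le _ x).trans ?_)
  calc ‖U (t - s) (V s f)‖ ≤ a (t - s) * (b s * ‖f‖) :=
        (U (t - s)).le_of_opNorm_le_of_le (hU.norm_le _) ((V s).le_of_opNorm_le (hV.norm_le s) f)
    _ = b s * a (t - s) * ‖f‖ := by ring

theorem IsDominatedFamily.ev_opIntegral_comp {a b : ℝ → ℝ} (hU : IsDominatedFamily volume a U)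
    (hV : IsDominatedFamily volume b V) (f : Bb X) (x : X) :
    ev x (opIntegral volume U (opIntegral volume V f)) =
      ∫ t : ℝ, ∫ s : ℝ, ev x (U (t - s) (V s f)) := calc
  _ = ∫ s, ev x (opIntegral volume U (V s f)) :=
    hU.isKernelOperator_opIntegral.ev_integral (hV.apply f) (hV.ev_opIntegral f) x
  _ = ∫ s : ℝ, ∫ t : ℝ, ev x (U (t - s) (V s f)) := integral_congr_ae (.of_forall fun s =>
    (hU.ev_opIntegral _ x).trans (integral_sub_right_eq_self (fun r => ev x (U r (V s f))) s).symm)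
  _ = ∫ t : ℝ, ∫ s : ℝ, ev x (U (t - s) (V s f)) :=
    (integral_integral_swap (hU.integrable_convolution hV f x)).symm

theorem IsExpBounded.laplace_convolution (hU : IsExpBounded U c ω) (hV : IsExpIntegrable V ψ ω)
    (hz : ω < z.re) : laplace (convolution U V) z = (laplace U z).comp (laplace V z) := by
  refine ContinuousLinearMap.ext fun f => ext_ev fun x => ?_
  rw [((hU.convolution hV).isExpIntegrable hz).ev_laplace le_rfl, ContinuousLinearMap.comp_apply,
    laplace, laplace, ((hU.isExpIntegrable hz).isDominatedFamily le_rfl).ev_opIntegral_comp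
      (hV.isDominatedFamily hz.le)]
  refine integral_congr_ae (.of_forall fun t => ?_)
  simp only [_root_.smul_apply, map_smul, smul_eq_mul, hU.ev_convolution hV,
    ← integral_const_mul, ← mul_assoc, ← Complex.exp_add]
  refine integral_congr_ae (.of_forall fun s => ?_)
  simp only
  congr 2
  push_cast
  ring

end Convolution

/-! ### The Volterra equation -/

section Volterra

variable {U V T K P : ℝ → Bb X →L[ℂ] Bb X} {c d ω s t : ℝ} {ψ : ℝ → ℝ}

theorem IsExpIntegrable.integral_nonneg (hK : IsExpIntegrable K ψ ω) : 0 ≤ ∫ s, ψ s :=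
  MeasureTheory.integral_nonneg hK.nonneg

theorem IsExpBounded.eq_zero_of_eq_convolution (hU : IsExpBounded U c ω)
    (hK : IsExpIntegrable K ψ ω) (hψ : ∫ s, ψ s < 1) (hUK : U = convolution U K) : U = 0 := by
  have geometric : ∀ n : ℕ, IsExpBounded U (c * (∫ s, ψ s) ^ n) ω := fun n => by
    induction n with
    | zero => simpa using hU
    | succ n ih =>
      rw [hUK, pow_succ, ← mul_assoc]
      exact ih.convolution hK
  have tendsto_zero (t : ℝ) :
      Tendsto (fun n : ℕ => c * (∫ s, ψ s) ^ n * Real.exp (ω * t)) atTop (𝓝 0) := by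
    simpa using ((tendsto_pow_atTop_nhds_zero_of_lt_one hK.integral_nonneg hψ).const_mul
      c).mul_const (Real.exp (ω * t))
  exact funext fun t => norm_le_zero_iff.1
    (ge_of_tendsto' (tendsto_zero t) fun n => (geometric n).norm_le t)

theorem IsExpBounded.eq_of_sub_convolution_eq (hU : IsExpBounded U c ω) (hV : IsExpBounded V d ω)
    (hK : IsExpIntegrable K ψ ω) (hψ : ∫ s, ψ s < 1)
    (h : ∀ t, U t - convolution U K t = V t - convolution V K t) : U = V := by
  refine sub_eq_zero.1 ((hU.sub hV).eq_zero_of_eq_convolution hK hψ (funext fun t => ?_))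
  rw [hU.convolution_sub hV hK, ← sub_eq_zero, sub_sub_sub_comm, h, sub_self]

section Series

variable {U : ℕ → ℝ → Bb X →L[ℂ] Bb X} {c : ℕ → ℝ}

theorem IsExpBounded.summable_norm (hU : ∀ n, IsExpBounded (U n) (c n) ω) (hc : Summable c)
    (t : ℝ) : Summable fun n => ‖U n t‖ :=
  .of_nonneg_of_le (fun _ => norm_nonneg _) (fun n => (hU n).norm_le t) (hc.mul_right _)

protected theorem IsExpBounded.tsum (hU : ∀ n, IsExpBounded (U n) (c n) ω) (hc : Summable c) :
    IsExpBounded (fun t => ∑' n, U n t) (∑' n, c n) ω where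
  family := .tsum (fun n => (hU n).family) (summable_norm hU hc)
  eq_zero t ht := by simp only [(hU _).eq_zero t ht, tsum_zero]
  norm_le t := tsum_of_norm_bounded (hc.hasSum.mul_right _) fun n => (hU n).norm_le t

theorem IsExpBounded.convolution_tsum (hU : ∀ n, IsExpBounded (U n) (c n) ω) (hc : Summable c)
    (hK : IsExpIntegrable K ψ ω) (t : ℝ) :
    convolution (fun t => ∑' n, U n t) K t = ∑' n, convolution (U n) K t := by
  have hUK : ∀ n, IsExpBounded (convolution (U n) K) (c n * ∫ s, ψ s) ω := fun n =>
    (hU n).convolution hK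
  refine ContinuousLinearMap.ext fun f => ext_ev fun x => ?_
  have dominated : ∀ n, IsDominated volume _ fun s => U n (t - s) (K s f) := fun n =>
    ((hU n).isDominatedFamily_convolution hK t).apply f
  rw [ev_tsum_apply (summable_norm hUK (hc.mul_right _) t).of_norm,
    (IsExpBounded.tsum hU hc).ev_convolution hK]
  simp only [ev_tsum_apply (summable_norm hU hc _).of_norm, (hU _).ev_convolution hK]
  refine (integral_tsum_of_summable_integral_norm (fun n => (dominated n).integrable_ev x)
    (.of_nonneg_of_le (fun n => MeasureTheory.integral_nonneg fun s => norm_nonneg _)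
      (fun n => integral_mono ((dominated n).integrable_ev x).norm (dominated n).integrable_bound
        ((dominated n).norm_ev_le x)) ?_)).symm
  simp only [integral_mul_const, integral_const_mul]
  exact ((hc.mul_right _).mul_right _).mul_right _

theorem IsExpBounded.continuous_tsum [TopologicalSpace X] (hU : ∀ n, IsExpBounded (U n) (c n) ω)
    (hc : Summable c) (hcont : ∀ n t f, Continuous fun x => ev x (U n t f)) (t : ℝ) (f : Bb X) :
    Continuous fun x => ev x ((∑' n, U n t) f) := by
  simp only [ev_tsum_apply (summable_norm hU hc t).of_norm]
  exact _root_.continuous_tsum (hcont · t f) ((summable_norm hU hc t).mul_right ‖f‖) fun n x =>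
    (norm_ev_le _ x).trans ((U n t).le_opNorm f)

end Series

theorem IsExpBounded.continuous_convolution [TopologicalSpace X] [FirstCountableTopology X]
    (hU : IsExpBounded U c ω) (hK : IsExpIntegrable K ψ ω)
    (hcont : ∀ t f, Continuous fun x => ev x (U t f)) (t : ℝ) (f : Bb X) :
    Continuous fun x => ev x (convolution U K t f) := by
  have dominated := (hU.isDominatedFamily_convolution hK t).apply f
  simp only [hU.ev_convolution hK]
  exact continuous_of_dominated (fun x => (dominated.integrable_ev x).aestronglyMeasurable)
    (fun x => .of_forall (dominated.norm_ev_le x)) dominated.integrable_bound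
    (.of_forall fun s => hcont _ _)

/-- The terms `T * K * ⋯ * K` of the Dyson–Phillips series. -/
def dysonPhillipsTerm (T K : ℝ → Bb X →L[ℂ] Bb X) : ℕ → ℝ → Bb X →L[ℂ] Bb X
  | 0 => T
  | n + 1 => convolution (dysonPhillipsTerm T K n) K

/-- The Dyson–Phillips series, which solves the Volterra equation `P = T + P * K`. -/
def dysonPhillips (T K : ℝ → Bb X →L[ℂ] Bb X) (t : ℝ) : Bb X →L[ℂ] Bb X :=
  ∑' n, dysonPhillipsTerm T K n t

theorem isExpBounded_dysonPhillipsTerm (hT : IsExpBounded T c ω) (hK : IsExpIntegrable K ψ ω)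
    (n : ℕ) : IsExpBounded (dysonPhillipsTerm T K n) (c * (∫ s, ψ s) ^ n) ω := by
  induction n with
  | zero => simpa [dysonPhillipsTerm] using hT
  | succ n ih =>
    rw [pow_succ, ← mul_assoc]
    exact ih.convolution hK

theorem summable_mul_integral_pow (hK : IsExpIntegrable K ψ ω) (hψ : ∫ s, ψ s < 1) (c : ℝ) :
    Summable fun n : ℕ => c * (∫ s, ψ s) ^ n :=
  (summable_geometric_of_lt_one hK.integral_nonneg hψ).mul_left c

theorem isExpBounded_dysonPhillips (hT : IsExpBounded T c ω) (hK : IsExpIntegrable K ψ ω)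
    (hψ : ∫ s, ψ s < 1) : IsExpBounded (dysonPhillips T K) (c * (1 - ∫ s, ψ s)⁻¹) ω := by
  rw [← tsum_geometric_of_lt_one hK.integral_nonneg hψ, ← tsum_mul_left]
  exact .tsum (isExpBounded_dysonPhillipsTerm hT hK) (summable_mul_integral_pow hK hψ c)

theorem dysonPhillips_eq (hT : IsExpBounded T c ω) (hK : IsExpIntegrable K ψ ω)
    (hψ : ∫ s, ψ s < 1) (t : ℝ) :
    dysonPhillips T K t = T t + convolution (dysonPhillips T K) K t := by
  have term := isExpBounded_dysonPhillipsTerm hT hK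
  have summable := summable_mul_integral_pow hK hψ c
  calc dysonPhillips T K t
      = dysonPhillipsTerm T K 0 t + ∑' n, dysonPhillipsTerm T K (n + 1) t :=
        (IsExpBounded.summable_norm term summable t).of_norm.tsum_eq_zero_add
    _ = T t + convolution (dysonPhillips T K) K t :=
        congrArg (T t + ·) (IsExpBounded.convolution_tsum term summable hK t).symm

theorem continuous_dysonPhillips [TopologicalSpace X] [FirstCountableTopology X]
    (hT : IsExpBounded T c ω) (hK : IsExpIntegrable K ψ ω) (hψ : ∫ s, ψ s < 1)
    (hcont : ∀ t f, Continuous fun x => ev x (T t f)) (t : ℝ) (f : Bb X) :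
    Continuous fun x => ev x (dysonPhillips T K t f) := by
  have term := isExpBounded_dysonPhillipsTerm hT hK
  refine IsExpBounded.continuous_tsum term (summable_mul_integral_pow hK hψ c) (fun n => ?_) t f
  induction n with
  | zero => exact hcont
  | succ n ih => exact (term n).continuous_convolution hK ih

protected theorem IsKernelFamily.causal (hU : IsKernelFamily U) : IsKernelFamily (causal U) := by
  have smul_indicator : causal U = fun s => (Ioi 0).indicator (1 : ℝ → ℂ) s • U s := by
    ext1 s
    by_cases hs : 0 < s <;> simp [causal, hs]
  rw [smul_indicator]
  exact hU.smul (measurable_one.indicator measurableSet_Ioi)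

theorem IsExpBounded.shift (hU : IsExpBounded U c ω) (t : ℝ) :
    IsExpBounded (causal fun s => U (t + s)) (c * Real.exp (ω * t)) ω where
  family := .causal ⟨fun s => hU.family.kernel _, fun f => (hU.family.measurable f).comp
    (by fun_prop : Measurable fun p : ℝ × X => (t + p.1, p.2))⟩
  eq_zero s hs := causal_of_nonpos _ hs
  norm_le s := by
    have := hU.nonneg
    rcases le_or_gt s 0 with hs | hs
    · rw [causal_of_nonpos _ hs, norm_zero]
      positivity
    · rw [causal_of_pos _ hs, mul_assoc, ← Real.exp_add, ← mul_add]
      exact hU.norm_le _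

theorem IsExpBounded.convolution_add (hU : IsExpBounded U c ω) (hK : IsExpIntegrable K ψ ω)
    {A : Bb X →L[ℂ] Bb X} (hA : ∀ r, 0 < r → K (r + s) = (K r).comp A) (t : ℝ) :
    convolution U K (t + s) =
      convolution (causal fun r => U (t + r)) K s + (convolution U K t).comp A := by
  refine ContinuousLinearMap.ext fun f => ext_ev fun x => ?_
  have integrable : Integrable fun r => ev x (U (t + s - r) (K r f)) :=
    ((hU.isDominatedFamily_convolution hK (t + s)).apply f).integrable_ev x
  rw [_root_.add_apply, map_add, ContinuousLinearMap.comp_apply, hU.ev_convolution hK,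
    hU.ev_convolution hK, (hU.shift t).ev_convolution hK,
    ← integral_add_compl measurableSet_Iio integrable (s := Iio s), compl_Iio]
  congr 1
  · rw [← integral_indicator measurableSet_Iio]
    refine integral_congr_ae (.of_forall fun r => ?_)
    by_cases hr : r < s
    · simp [causal, hr, add_sub_assoc]
    · simp [causal, hr]
  · rw [integral_Ici_eq_integral_Ioi, ← integral_indicator measurableSet_Ioi,
      ← integral_add_right_eq_self _ s]
    refine integral_congr_ae (.of_forall fun r => ?_)
    rcases le_or_gt r 0 with hr | hr
    · simp [hr.not_gt, hK.eq_zero r hr]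
    · simp [hr, hA r hr, add_sub_add_right_eq_sub]

theorem IsExpBounded.comp_of_eq_add_convolution (hP : IsExpBounded P c ω)
    (hK : IsExpIntegrable K ψ ω) (hψ : ∫ s, ψ s < 1) (hPK : ∀ t, P t = T t + convolution P K t)
    (hT_add : ∀ t s, 0 < t → 0 < s → T (t + s) = (T t).comp (T s))
    (hK_add : ∀ t s, 0 < t → 0 < s → K (t + s) = (K t).comp (T s)) (ht : 0 < t) (hs : 0 < s) :
    P (t + s) = (P t).comp (P s) := by
  have hPK' : ∀ t, convolution P K t = P t - T t := fun t => eq_sub_of_add_eq' (hPK t).symm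
  have shift := hP.shift t
  have comp := hP.comp_left (hP.family.kernel t)
  suffices causal (fun s => P (t + s)) = fun s => (P t).comp (P s) from
    (causal_of_pos _ hs).symm.trans (congrFun this s)
  refine shift.eq_of_sub_convolution_eq comp hK hψ fun s => ?_
  rcases le_or_gt s 0 with hs | hs
  · rw [shift.eq_zero s hs, (shift.convolution hK).eq_zero s hs, comp.eq_zero s hs,
      (comp.convolution hK).eq_zero s hs]
  · rw [causal_of_pos _ hs, eq_sub_of_add_eq
      (hP.convolution_add hK (fun r hr => hK_add r s hr hs) t).symm, ← hP.comp_convolution hK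
      (hP.family.kernel t), hPK', hPK', hPK', hT_add t s ht hs, ContinuousLinearMap.sub_comp,
      ContinuousLinearMap.comp_sub]
    abel

end Volterra

/-! ### Strong Feller semigroups and their resolvents -/

section Semigroup

theorem tendsto_floor_add_one_div_nhdsGT (t : ℝ) :
    Tendsto (fun n : ℕ => ((⌊t * (n + 1)⌋ : ℝ) + 1) / (n + 1)) atTop (𝓝[>] t) := by
  have pos (n : ℕ) : (0 : ℝ) < n + 1 := by positivity
  have lower (n : ℕ) : t < ((⌊t * (n + 1)⌋ : ℝ) + 1) / (n + 1) :=
    (lt_div_iff₀ (pos n)).2 (Int.lt_floor_add_one _)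
  have upper (n : ℕ) : ((⌊t * (n + 1)⌋ : ℝ) + 1) / (n + 1) ≤ t + 1 / (n + 1) := by
    rw [div_le_iff₀ (pos n), add_mul, one_div_mul_cancel (pos n).ne']
    linarith [Int.floor_le (t * (n + 1))]
  refine tendsto_nhdsWithin_iff.2 ⟨tendsto_of_tendsto_of_tendsto_of_le_of_le tendsto_const_nhds ?_
    (fun n => (lower n).le) upper, .of_forall lower⟩
  simpa using tendsto_one_div_add_atTop_nhds_zero_nat.const_add t

theorem tendsto_sub_const_nhdsGT (a t : ℝ) :
    Tendsto (fun s => s - a) (𝓝[>] t) (𝓝[>] (t - a)) :=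
  tendsto_nhdsWithin_iff.2 ⟨((continuous_sub_right a).tendsto t).mono_left nhdsWithin_le_nhds,
    eventually_mem_nhdsWithin.mono fun _ hs => sub_lt_sub_right (mem_Ioi.1 hs) a⟩

theorem measurable_indicator_Ioi_of_tendsto_nhdsGT {a : ℝ} {F : ℝ → X → ℂ}
    (hF : ∀ t, Measurable (F t)) (h : ∀ t, a < t → ∀ x, Tendsto (F · x) (𝓝[>] t) (𝓝 (F t x))) :
    Measurable fun p : ℝ × X => (Ioi a).indicator (F · p.2) p.1 := by
  let G (n : ℕ) : ℝ × X → ℂ :=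
    {p | a < p.1}.indicator fun p => F (((⌊p.1 * (n + 1)⌋ : ℝ) + 1) / (n + 1)) p.2
  have measurable_G (n : ℕ) : Measurable (G n) := by
    have step : Measurable fun q : ℤ × X => F (((q.1 : ℝ) + 1) / (n + 1)) q.2 :=
      measurable_from_prod_countable_right fun k => hF (((k : ℝ) + 1) / (n + 1))
    exact (step.comp (by fun_prop : Measurable fun p : ℝ × X => (⌊p.1 * (n + 1)⌋, p.2))).indicator
      (measurableSet_lt measurable_const measurable_fst)
  refine measurable_of_tendsto_metrizable measurable_G (tendsto_pi_nhds.2 fun p => ?_)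
  by_cases hp : a < p.1
  · simpa [G, hp, Function.comp_def] using
      (h p.1 hp p.2).comp (tendsto_floor_add_one_div_nhdsGT p.1)
  · simp [G, hp]

theorem isKernelFamily_causal_of_tendsto_nhdsGT {U : ℝ → Bb X →L[ℂ] Bb X}
    (hU : ∀ t, 0 < t → IsKernelOperator (U t))
    (h : ∀ t, 0 < t → ∀ f x, Tendsto (fun s => ev x (U s f)) (𝓝[>] t) (𝓝 (ev x (U t f)))) :
    IsKernelFamily (causal U) := by
  refine ⟨fun t => ?_, fun f => ?_⟩
  · rcases le_or_gt t 0 with ht | ht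
    · rw [causal_of_nonpos U ht]
      exact .zero
    · rw [causal_of_pos U ht]
      exact hU t ht
  · convert measurable_indicator_Ioi_of_tendsto_nhdsGT (fun t => measurable_ev (U t f))
      (fun t ht x => h t ht f x) using 2 with p
    by_cases hp : 0 < p.1 <;> simp [causal, hp]

variable {T : ℝ → Bb X →L[ℂ] Bb X} {C ω ω' : ℝ} {z w : ℂ}

theorem IsOfType.nonneg (htype : IsOfType T C ω) : 0 ≤ C := zero_le_one.trans htype.1

theorem IsOfType.mono (htype : IsOfType T C ω) (hω : ω ≤ ω') : IsOfType T C ω' := by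
  have := htype.nonneg
  exact ⟨htype.1, fun t ht => (htype.2 t ht).trans (by gcongr)⟩

theorem IsOfType.bpTendsto_nhdsGT (htype : IsOfType T C ω) {t : ℝ} (ht : 0 ≤ t) {f g : Bb X}
    (h : ∀ x, Tendsto (fun s => ev x (T s f)) (𝓝[>] t) (𝓝 (ev x g))) :
    BPTendsto (fun s => T s f) (𝓝[>] t) g := by
  have bound : Tendsto (fun s => C * Real.exp (ω * s) * ‖f‖) (𝓝[>] t)
      (𝓝 (C * Real.exp (ω * t) * ‖f‖)) :=
    (Continuous.tendsto (by fun_prop) t).mono_left nhdsWithin_le_nhds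
  refine ⟨⟨C * Real.exp (ω * t) * ‖f‖ + 1, ?_⟩, h⟩
  filter_upwards [bound.eventually_le_const (lt_add_one _), self_mem_nhdsWithin] with s hs hts
  exact ((T s).le_of_opNorm_le (htype.2 s (ht.trans (le_of_lt hts))) f).trans hs

theorem IsExpIntegrable.commute_laplace {U : ℝ → Bb X →L[ℂ] Bb X} {ψ : ℝ → ℝ}
    (hU : IsExpIntegrable U ψ ω) (hz : ω ≤ z.re) {A : Bb X →L[ℂ] Bb X} (hA : IsKernelOperator A)
    (h : ∀ s, Commute A (U s)) : Commute A (laplace U z) :=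
  (hU.comp_laplace hz hA).trans <|
    (congrArg (laplace · z) (funext h)).trans (hU.laplace_comp hz A).symm

theorem tendsto_inv_smul_integral_nhdsGT {h : ℝ → ℂ} {c : ℂ} (hh : Integrable h)
    (hc : Tendsto h (𝓝[>] 0) (𝓝 c)) :
    Tendsto (fun t : ℝ => t⁻¹ • ∫ s in (0 : ℝ)..t, h s) (𝓝[>] 0) (𝓝 c) := by
  have derivative : HasDerivWithinAt (fun t => ∫ s in (0 : ℝ)..t, h s) c (Ioi 0) 0 :=
    (intervalIntegral.integral_hasDerivWithinAt_of_tendsto_ae_right (s := Ici 0) (t := Ioi 0)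
      hh.intervalIntegrable (hh.aestronglyMeasurable.stronglyMeasurableAtFilter)
      (hc.mono_left inf_le_left)).mono Ioi_subset_Ici_self
  simpa [slope_fun_def] using (hasDerivWithinAt_iff_tendsto_slope' self_notMem_Ioi).1 derivative

variable [TopologicalSpace X]

namespace IsStrongFellerSemigroup

theorem isKernelOperator (hT : IsStrongFellerSemigroup T) {t : ℝ} (ht : 0 ≤ t) :
    IsKernelOperator (T t) :=
  isSigmaContinuous_iff.1 (hT.sigmaContinuous t ht)

theorem continuous_ev_causal (hT : IsStrongFellerSemigroup T) (t : ℝ) (f : Bb X) :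
    Continuous fun x => ev x (causal T t f) := by
  rcases le_or_gt t 0 with ht | ht
  · rw [causal_of_nonpos T ht]
    exact continuous_const
  · rw [causal_of_pos T ht]
    exact hT.strongFeller t ht f

theorem tendsto_ev_zero (hT : IsStrongFellerSemigroup T) {f : Bb X}
    (hf : Continuous fun x => ev x f) (x : X) :
    Tendsto (fun t => ev x (T t f)) (𝓝[>] 0) (𝓝 (ev x f)) :=
  tendsto_ev_of_sigma (hT.tendsto_zero f hf) x

theorem tendsto_ev_nhdsGT (hT : IsStrongFellerSemigroup T) {t : ℝ} (ht : 0 < t) (f : Bb X)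
    (x : X) : Tendsto (fun s => ev x (T s f)) (𝓝[>] t) (𝓝 (ev x (T t f))) := by
  have sub_right := tendsto_sub_const_nhdsGT t t
  rw [sub_self] at sub_right
  refine ((hT.tendsto_ev_zero (hT.strongFeller t ht f) x).comp sub_right).congr' ?_
  filter_upwards [self_mem_nhdsWithin] with s hs
  have semigroup := hT.map_add t (s - t) ht.le (sub_nonneg.2 (le_of_lt hs))
  rw [sub_add_cancel] at semigroup
  rw [semigroup]
  rfl

theorem isExpBounded (hT : IsStrongFellerSemigroup T) (htype : IsOfType T C ω) :
    IsExpBounded (causal T) C ω where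
  family := isKernelFamily_causal_of_tendsto_nhdsGT (fun t ht => hT.isKernelOperator ht.le)
    fun t ht => hT.tendsto_ev_nhdsGT ht
  eq_zero t ht := causal_of_nonpos T ht
  norm_le t := by
    have := htype.nonneg
    rcases le_or_gt t 0 with ht | ht
    · rw [causal_of_nonpos T ht, norm_zero]
      positivity
    · rw [causal_of_pos T ht]
      exact htype.2 t ht.le

theorem isExpIntegrable (hT : IsStrongFellerSemigroup T) (htype : IsOfType T C ω)
    (hz : ω < z.re) : IsExpIntegrable (causal T)
      ((Ioi 0).indicator fun s => C * Real.exp (-(z.re - ω) * s)) z.re :=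
  (hT.isExpBounded htype).isExpIntegrable hz

theorem isLaplaceTransform_iff (hT : IsStrongFellerSemigroup T) (htype : IsOfType T C ω)
    (hz : ω < z.re) {f u : Bb X} : IsLaplaceTransform T z f u ↔ laplace (causal T) z f = u := by
  have integrable := hT.isExpIntegrable htype hz
  have ae_eq : (fun t : ℝ => Complex.exp (-(z * t)) • T t f) =ᵐ[volume.restrict (Ioi 0)]
      fun t : ℝ => (Complex.exp (-(z * t)) • causal T t) f := by
    filter_upwards [self_mem_ae_restrict measurableSet_Ioi] with t ht
    rw [causal_of_pos T ht, _root_.smul_apply]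
  have ev_laplace (x : X) : ev x (laplace (causal T) z f) =
      ∫ t : ℝ in Ioi 0, ev x ((Complex.exp (-(z * t)) • causal T t) f) :=
    (integrable.ev_laplace le_rfl f x).trans
      (setIntegral_eq_integral_of_forall_compl_eq_zero fun t ht => by
        simp [causal_of_nonpos T (not_lt.1 ht)]).symm
  refine ⟨fun h => ext_ev fun x => ?_, ?_⟩
  · exact (ev_laplace x).trans ((h.congr_ae ae_eq).ev_eq x).symm
  · rintro rfl
    exact ((((integrable.isDominatedFamily le_rfl).apply f).restrict _).hasWeakIntegral
      ev_laplace).congr_ae ae_eq.symm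

theorem commute_causal (hT : IsStrongFellerSemigroup T) {t : ℝ} (ht : 0 ≤ t) (s : ℝ) :
    Commute (T t) (causal T s) := by
  rcases le_or_gt s 0 with hs | hs
  · rw [causal_of_nonpos T hs]
    exact .zero_right _
  · rw [causal_of_pos T hs]
    exact (hT.map_add s t hs.le ht).symm.trans ((add_comm t s ▸ hT.map_add t s ht hs.le))

theorem commute_laplace (hT : IsStrongFellerSemigroup T) (htype : IsOfType T C ω)
    (hz : ω < z.re) {t : ℝ} (ht : 0 ≤ t) : Commute (T t) (laplace (causal T) z) :=
  (hT.isExpIntegrable htype hz).commute_laplace le_rfl (hT.isKernelOperator ht)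
    (hT.commute_causal ht)

theorem laplace_commute_laplace (hT : IsStrongFellerSemigroup T) (htype : IsOfType T C ω)
    (hz : ω < z.re) (hw : ω < w.re) :
    Commute (laplace (causal T) z) (laplace (causal T) w) := by
  refine (hT.isExpIntegrable htype hw).commute_laplace le_rfl
    ((hT.isExpIntegrable htype hz).isKernelOperator_laplace le_rfl) fun s => ?_
  rcases le_or_gt s 0 with hs | hs
  · rw [causal_of_nonpos T hs]
    exact .zero_right _
  · rw [causal_of_pos T hs]
    exact (hT.commute_laplace htype hz hs.le).symm

theorem convolution_exp_smul (hT : IsStrongFellerSemigroup T) (a : ℂ) (t : ℝ) :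
    convolution (causal T) (fun s : ℝ => Complex.exp (a * s) • causal T s) t =
      (∫ s : ℝ in Ioo 0 t, Complex.exp (a * s)) • causal T t := by
  refine opIntegral_eq fun f x => ?_
  rw [_root_.smul_apply, map_smul, smul_eq_mul, ← integral_mul_const,
    ← integral_indicator measurableSet_Ioo]
  refine integral_congr_ae (.of_forall fun s => ?_)
  by_cases hs : s ∈ Ioo 0 t
  · have semigroup := hT.map_add s (t - s) hs.1.le (sub_nonneg.2 hs.2.le)
    rw [sub_add_cancel] at semigroup
    simp [hs, causal_of_pos, hs.1, hs.2, hs.1.trans hs.2, semigroup]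
  · rw [mem_Ioo, not_and_or, not_lt, not_lt] at hs
    rcases hs with hs | hs
    · simp [causal_of_nonpos T hs, hs.not_gt]
    · simp [causal_of_nonpos T (sub_nonpos.2 hs), hs.not_gt]

theorem smul_convolution_exp_smul (hT : IsStrongFellerSemigroup T) (a : ℂ) (t : ℝ) :
    a • convolution (causal T) (fun s : ℝ => Complex.exp (a * s) • causal T s) t =
      Complex.exp (a * t) • causal T t - causal T t := by
  rcases eq_or_ne a 0 with rfl | ha
  · simp
  rcases le_or_gt t 0 with ht | ht
  · simp [hT.convolution_exp_smul, causal_of_nonpos T ht]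
  rw [hT.convolution_exp_smul, ← integral_Ioc_eq_integral_Ioo, ← intervalIntegral.integral_of_le
    ht.le, integral_exp_mul_complex ha, smul_smul, mul_div_cancel₀ _ ha, sub_smul]
  simp

theorem resolvent_identity (hT : IsStrongFellerSemigroup T) (htype : IsOfType T C ω)
    (hz : ω < z.re) (hw : ω < w.re) :
    (z - w) • (laplace (causal T) z).comp (laplace (causal T) w) =
      laplace (causal T) w - laplace (causal T) z := by
  let V : ℝ → Bb X →L[ℂ] Bb X := fun s => Complex.exp ((z - w) * s) • causal T s
  have laplace_V : laplace V z = laplace (causal T) w := by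
    rw [laplace_exp_smul, sub_sub_cancel]
  obtain ⟨r, hr, hrz⟩ : ∃ r, max ω (ω + (z - w).re) < r ∧ r < z.re :=
    exists_between (max_lt hz (by rw [Complex.sub_re]; linarith))
  have hωr : ω < r := (le_max_left _ _).trans_lt hr
  have hTr : IsExpBounded (causal T) C r := hT.isExpBounded (htype.mono hωr.le)
  have hVr := ((hT.isExpBounded htype).exp_smul (z - w)).isExpIntegrable
    ((le_max_right _ _).trans_lt hr)
  calc (z - w) • (laplace (causal T) z).comp (laplace (causal T) w)
      = (z - w) • laplace (convolution (causal T) V) z := by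
        rw [hTr.laplace_convolution hVr hrz, laplace_V]
    _ = laplace (fun t => (z - w) • convolution (causal T) V t) z :=
        ((hTr.convolution hVr).isExpIntegrable hrz).comp_laplace le_rfl
          (IsKernelOperator.id.smul (z - w))
    _ = laplace (fun t => V t - causal T t) z := by
        simp only [V, hT.smul_convolution_exp_smul]
    _ = laplace (causal T) w - laplace (causal T) z := by
        rw [hVr.laplace_sub ((hT.isExpBounded htype).isExpIntegrable hωr) hrz.le, laplace_V]

theorem laplace_smul_sub_laplace (hT : IsStrongFellerSemigroup T) (htype : IsOfType T C ω)
    (hz : ω < z.re) (hw : ω < w.re) (f : Bb X) :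
    laplace (causal T) w (w • laplace (causal T) z f - (z • laplace (causal T) z f - f)) =
      laplace (causal T) z f := by
  have identity := DFunLike.congr_fun (hT.resolvent_identity htype hw hz) f
  simp only [_root_.smul_apply, ContinuousLinearMap.comp_apply, _root_.sub_apply] at identity
  rw [← sub_add, ← sub_smul, _root_.map_add, map_smul, identity, sub_add_cancel]

theorem mem_fullGenerator_iff (hT : IsStrongFellerSemigroup T) (htype : IsOfType T C ω)
    (hz : ω < z.re) {f g : Bb X} :
    (f, g) ∈ fullGenerator T ↔ laplace (causal T) z (z • f - g) = f := by
  constructor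
  · rintro ⟨C', ω', htype', h⟩
    obtain ⟨r, hr⟩ := exists_gt (max ω ω')
    have hωw : ω < (r : ℂ).re := (le_max_left _ _).trans_lt hr
    have hωw' : ω' < (r : ℂ).re := (le_max_right _ _).trans_lt hr
    have resolvent_eq := (hT.isLaplaceTransform_iff htype' hωw').1 (h r hωw')
    have := hT.laplace_smul_sub_laplace htype hωw hz ((r : ℂ) • f - g)
    rwa [resolvent_eq, sub_sub_cancel] at this
  · intro h
    refine ⟨C, ω, htype, fun w hw => (hT.isLaplaceTransform_iff htype hw).2 ?_⟩
    have := hT.laplace_smul_sub_laplace htype hz hw (z • f - g)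
    rwa [h, sub_sub_cancel] at this

theorem laplace_mem_domain (hT : IsStrongFellerSemigroup T) (htype : IsOfType T C ω)
    (hz : ω < z.re) (f : Bb X) : laplace (causal T) z f ∈ domain (fullGenerator T) :=
  ⟨z • laplace (causal T) z f - f,
    (hT.mem_fullGenerator_iff htype hz).2 (by rw [sub_sub_cancel])⟩

theorem ev_laplace_exp_smul_map (hT : IsStrongFellerSemigroup T) (htype : IsOfType T C ω)
    (hz : ω < z.re) {t : ℝ} (ht : 0 ≤ t) (f : Bb X) (x : X) :
    ev x (laplace (causal T) z (Complex.exp (-(z * t)) • T t f)) =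
      ∫ s in Ioi t, ev x ((Complex.exp (-(z * s)) • causal T s) f) := by
  rw [(hT.isExpIntegrable htype hz).ev_laplace le_rfl, ← integral_indicator measurableSet_Ioi,
    ← integral_add_right_eq_self ((Ioi t).indicator _) t]
  refine integral_congr_ae (.of_forall fun s => ?_)
  rcases le_or_gt s 0 with hs | hs
  · simp [causal_of_nonpos T hs, hs.not_gt]
  · have exp_add : Complex.exp (-(z * (s + t))) =
        Complex.exp (-(z * t)) * Complex.exp (-(z * s)) := by
      rw [← Complex.exp_add]
      ring_nf
    simp [causal_of_pos T hs, causal_of_pos T (add_pos_of_pos_of_nonneg hs ht), hs,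
      hT.map_add t s ht hs.le, exp_add, mul_assoc]

theorem ev_laplace_sub_exp_smul_map (hT : IsStrongFellerSemigroup T) (htype : IsOfType T C ω)
    (hz : ω < z.re) {t : ℝ} (ht : 0 ≤ t) (f : Bb X) (x : X) :
    ev x (laplace (causal T) z (f - Complex.exp (-(z * t)) • T t f)) =
      ∫ s in (0 : ℝ)..t, ev x ((Complex.exp (-(z * s)) • causal T s) f) := by
  have integrable :=
    (((hT.isExpIntegrable htype hz).isDominatedFamily le_rfl).apply f).integrable_ev x
  have integral_Ioi : ∫ s in Ioi (0 : ℝ), ev x ((Complex.exp (-(z * s)) • causal T s) f) =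
      ∫ s : ℝ, ev x ((Complex.exp (-(z * s)) • causal T s) f) :=
    setIntegral_eq_integral_of_forall_compl_eq_zero fun s hs => by
      simp [causal_of_nonpos T (not_lt.1 hs)]
  rw [map_sub, map_sub, hT.ev_laplace_exp_smul_map htype hz ht,
    ← intervalIntegral.integral_Ioi_sub_Ioi integrable.integrableOn ht, integral_Ioi,
    (hT.isExpIntegrable htype hz).ev_laplace le_rfl]

theorem bpTendsto_inv_smul_laplace (hT : IsStrongFellerSemigroup T) (htype : IsOfType T C ω)
    (hz : ω < z.re) {f : Bb X} (hf : Continuous fun x => ev x f) :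
    BPTendsto (fun t : ℝ => laplace (causal T) z
      ((t⁻¹ : ℂ) • (f - Complex.exp (-(z * t)) • T t f))) (𝓝[>] 0) f := by
  have dominated := ((hT.isExpIntegrable htype hz).isDominatedFamily le_rfl).apply f
  have ev_eq {t : ℝ} (ht : 0 < t) (x : X) : ev x (laplace (causal T) z
      ((t⁻¹ : ℂ) • (f - Complex.exp (-(z * t)) • T t f))) =
      t⁻¹ • ∫ s in (0 : ℝ)..t, ev x ((Complex.exp (-(z * s)) • causal T s) f) := by
    rw [map_smul, map_smul, hT.ev_laplace_sub_exp_smul_map htype hz ht.le, ← Complex.ofReal_inv,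
      Complex.coe_smul]
  refine ⟨⟨C * ‖f‖, ?_⟩, fun x => ?_⟩
  · have norm_le {s : ℝ} (hs : 0 < s) (x : X) :
        ‖ev x ((Complex.exp (-(z * s)) • causal T s) f)‖ ≤ C * ‖f‖ := by
      refine (dominated.norm_ev_le x s).trans ?_
      have := htype.nonneg
      rw [indicator_of_mem (mem_Ioi.2 hs)]
      gcongr
      refine mul_le_of_le_one_right this (Real.exp_le_one_iff.2 ?_)
      nlinarith
    filter_upwards [self_mem_nhdsWithin] with t ht
    refine norm_le_of_ev (mul_nonneg htype.nonneg (norm_nonneg f)) fun x => ?_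
    have := intervalIntegral.norm_integral_le_of_norm_le_const fun s hs =>
      norm_le (s := s) (uIoc_of_le (le_of_lt (mem_Ioi.1 ht)) ▸ hs).1 x
    rw [ev_eq ht, norm_smul, norm_inv, inv_mul_le_iff₀ (norm_pos_iff.2 (ne_of_gt ht)), mul_comm]
    simpa using this
  · refine (tendsto_inv_smul_integral_nhdsGT (dominated.integrable_ev x) ?_).congr' ?_
    · have exp_tendsto : Tendsto (fun s : ℝ => Complex.exp (-(z * s))) (𝓝[>] 0) (𝓝 1) :=
        (Continuous.tendsto' (by fun_prop) 0 1 (by simp)).mono_left nhdsWithin_le_nhds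
      refine (one_mul (ev x f) ▸ exp_tendsto.mul (hT.tendsto_ev_zero hf x)).congr' ?_
      filter_upwards [self_mem_nhdsWithin] with s hs
      rw [causal_of_pos T hs, _root_.smul_apply, map_smul, smul_eq_mul]
    · filter_upwards [self_mem_nhdsWithin] with t ht using (ev_eq ht x).symm

end IsStrongFellerSemigroup

theorem IsKernelOperator.ext_of_continuous [HasOuterApproxClosed X] [BorelSpace X]
    {A B : Bb X →L[ℂ] Bb X} (hA : IsKernelOperator A) (hB : IsKernelOperator B)
    (h : ∀ f, Continuous (fun x => ev x f) → A f = B f) : A = B := by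
  have lim {f : ℕ → Bb X} {g : Bb X} (hfg : BPTendsto f atTop g) (hf : ∀ n, A (f n) = B (f n)) :
      A g = B g := by
    refine ext_ev fun x => tendsto_nhds_unique (hA x f g hfg) ?_
    simp only [hf]
    exact hB x f g hfg
  have closed {F : Set X} (hF : IsClosed F) : A (Bb.ind F) = B (Bb.ind F) := by
    have appr_le_one (n x) : ‖((hF.apprSeq n x : ℝ) : ℂ)‖ ≤ 1 := by
      rw [Complex.norm_real, Real.norm_of_nonneg NNReal.zero_le_coe]
      exact_mod_cast HasOuterApproxClosed.apprSeq_apply_le_one hF n x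
    have continuous_appr (n) : Continuous fun x => ((hF.apprSeq n x : ℝ) : ℂ) :=
      Complex.continuous_ofReal.comp (NNReal.continuous_coe.comp (hF.apprSeq n).continuous)
    refine lim (f := fun n => Bb.mk _ (continuous_appr n).measurable (appr_le_one n))
      ⟨⟨1, .of_forall fun n => norm_le_of_ev zero_le_one (appr_le_one n)⟩, fun x => ?_⟩
      fun n => h _ (continuous_appr n)
    have tendsto_appr := tendsto_pi_nhds.1 (HasOuterApproxClosed.tendsto_apprSeq hF) x
    have ev_ind_eq : ev x (Bb.ind F) = (((F.indicator (fun _ => 1) x : NNReal) : ℝ) : ℂ) := by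
      rw [ev_ind hF.measurableSet]
      by_cases hx : x ∈ F <;> simp [hx]
    rw [ev_ind_eq]
    exact ((Complex.continuous_ofReal.comp NNReal.continuous_coe).tendsto _).comp tendsto_appr
  ext1 f
  induction f using Bb.induction_piSystem
    (BorelSpace.measurable_eq.trans (borel_eq_generateFrom_isClosed (α := X)))
    isPiSystem_isClosed with
  | univ c => rw [map_smul, map_smul, closed isClosed_univ]
  | basic c F hF => rw [map_smul, map_smul, closed hF]
  | add f g hf hg => rw [map_add, map_add, hf, hg]
  | lim f g hfg hf => exact lim hfg hf

theorem IsStrongFellerSemigroup.ext_of_laplace [HasOuterApproxClosed X] [BorelSpace X]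
    (hT : IsStrongFellerSemigroup T) (htype : IsOfType T C ω) (hz : ω < z.re)
    {A B : Bb X →L[ℂ] Bb X} (hA : IsKernelOperator A) (hB : IsKernelOperator B)
    (h : A.comp (laplace (causal T) z) = B.comp (laplace (causal T) z)) : A = B := by
  refine hA.ext_of_continuous hB fun f hf => ext_ev fun x => ?_
  have approx := hT.bpTendsto_inv_smul_laplace htype hz hf
  refine tendsto_nhds_unique (((hA x).tendsto approx).congr fun t => ?_) ((hB x).tendsto approx)
  exact congrArg (ev x) (DFunLike.congr_fun h _)

end Semigroup

/-! ### Exponentially integrable majorants -/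

section Majorant

variable {K : ℝ → Bb X →L[ℂ] Bb X} {ψ φ : ℝ → ℝ} {c ω ω' : ℝ}

theorem IsKernelFamily.exists_isExpIntegrable (hK : IsKernelFamily K) (hK_zero : ∀ t ≤ 0, K t = 0)
    (hφ : IntegrableOn φ (Ioc 0 1)) (hKφ : ∀ t ∈ Ioc (0 : ℝ) 1, ‖K t‖ ≤ φ t)
    (hKc : ∀ t, 1 < t → ‖K t‖ ≤ c * Real.exp (ω * t)) (hω : ω < ω') :
    ∃ ψ, IsExpIntegrable K ψ ω' := by
  refine ⟨(Ioc 0 1).indicator (fun s => Real.exp (-(ω' * s)) * φ s) +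
    (Ioi 1).indicator (fun s => c * Real.exp (-(ω' - ω) * s)), hK, hK_zero, ?_, fun s => ?_⟩
  · have integrableOn_Ioc : IntegrableOn (fun s => Real.exp (-(ω' * s)) * φ s) (Ioc 0 1) := by
      rw [← integrableOn_Icc_iff_integrableOn_Ioc] at hφ ⊢
      exact hφ.continuousOn_mul (by fun_prop) isCompact_Icc
    have integrableOn_Ioi : IntegrableOn (fun s => c * Real.exp (-(ω' - ω) * s)) (Ioi 1) :=
      (exp_neg_integrableOn_Ioi 1 (sub_pos.2 hω)).const_mul c
    exact (integrableOn_Ioc.integrable_indicator measurableSet_Ioc).add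
      (integrableOn_Ioi.integrable_indicator measurableSet_Ioi)
  · rw [Pi.add_apply]
    rcases le_or_gt s 0 with h0 | h0
    · simp [hK_zero s h0, h0.not_gt, (h0.trans zero_le_one).not_gt]
    rcases le_or_gt s 1 with h1 | h1
    · simpa [h0, h1, h1.not_gt, ← mul_assoc, ← Real.exp_add] using hKφ s ⟨h0, h1⟩
    · refine (hKc s h1).trans_eq ?_
      rw [indicator_of_notMem fun hs => h1.not_ge hs.2, indicator_of_mem (mem_Ioi.2 h1), zero_add,
        mul_left_comm, ← Real.exp_add]
      ring_nf

theorem IsExpIntegrable.exists_integral_lt_one (hK : IsExpIntegrable K ψ ω) :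
    ∃ ψ' ω', ω ≤ ω' ∧ IsExpIntegrable K ψ' ω' ∧ ∫ s, ψ' s < 1 := by
  let χ (n : ℕ) (s : ℝ) : ℝ := Real.exp (-(n * s)) * (Ioi 0).indicator ψ s
  have integrable_bound := hK.integrable.indicator (measurableSet_Ioi (a := (0 : ℝ)))
  have aestronglyMeasurable_χ (n : ℕ) : AEStronglyMeasurable (χ n) :=
    AEStronglyMeasurable.mul (by fun_prop) integrable_bound.aestronglyMeasurable
  have norm_χ_le (n : ℕ) (s : ℝ) : ‖χ n s‖ ≤ ‖(Ioi 0).indicator ψ s‖ := by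
    rcases le_or_gt s 0 with hs | hs
    · simp [χ, hs.not_gt]
    · rw [norm_mul]
      refine mul_le_of_le_one_left (norm_nonneg _) ?_
      rw [Real.norm_of_nonneg (Real.exp_nonneg _), Real.exp_le_one_iff, neg_nonpos]
      positivity
  have tendsto_χ (s : ℝ) : Tendsto (χ · s) atTop (𝓝 0) := by
    rcases le_or_gt s 0 with hs | hs
    · simp [χ, hs.not_gt]
    · simpa [χ] using (Real.tendsto_exp_neg_atTop_nhds_zero.comp
        (tendsto_natCast_atTop_atTop.atTop_mul_const hs)).mul_const ((Ioi 0).indicator ψ s)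
  have tendsto_integral := tendsto_integral_of_dominated_convergence _ aestronglyMeasurable_χ
    integrable_bound.norm (fun n => .of_forall (norm_χ_le n)) (.of_forall tendsto_χ)
  rw [integral_zero] at tendsto_integral
  obtain ⟨n, hn⟩ := (tendsto_integral.eventually_lt_const one_pos).exists
  refine ⟨χ n, ω + n, le_add_of_nonneg_right n.cast_nonneg, ⟨hK.family, hK.eq_zero,
    integrable_bound.norm.mono' (aestronglyMeasurable_χ n) (.of_forall (norm_χ_le n)),
    fun s => ?_⟩, hn⟩
  rcases le_or_gt s 0 with hs | hs
  · simp [χ, hK.eq_zero s hs, hs.not_gt]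
  · refine (hK.norm_le s).trans_eq ?_
    simp only [χ]
    rw [indicator_of_mem (mem_Ioi.2 hs), ← mul_assoc, ← Real.exp_add]
    ring_nf

end Majorant

/-! ### Solutions of the variation of constants equation -/

section VariationOfConstants

variable {T P K : ℝ → Bb X →L[ℂ] Bb X} {c d ω : ℝ} {ψ : ℝ → ℝ} {z : ℂ}

theorem IsExpBounded.laplace_eq_of_eq_add_convolution (hT : IsExpBounded T c ω)
    (hP : IsExpBounded P d ω) (hK : IsExpIntegrable K ψ ω)
    (hPK : ∀ t, P t = T t + convolution P K t) (hz : ω < z.re) :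
    laplace P z = laplace T z + (laplace P z).comp (laplace K z) := by
  have convolution_eq : convolution P K = fun t => P t - T t :=
    funext fun t => eq_sub_of_add_eq' (hPK t).symm
  rw [← hP.laplace_convolution hK hz, convolution_eq,
    (hP.isExpIntegrable hz).laplace_sub (hT.isExpIntegrable hz) le_rfl, add_sub_cancel]

theorem IsExpBounded.tendsto_convolution_nhdsGT_zero (hP : IsExpBounded P c ω)
    (hK : IsExpIntegrable K ψ ω) (f : Bb X) (x : X) :
    Tendsto (fun t => ev x (convolution P K t f)) (𝓝[>] 0) (𝓝 0) := by
  have dominated (t : ℝ) := (hP.isDominatedFamily_convolution hK t).apply f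
  have norm_le {t : ℝ} (ht : t ∈ Ioo (0 : ℝ) 1) (s : ℝ) :
      ‖ev x (P (t - s) (K s f))‖ ≤ c * Real.exp |ω| * ψ s * ‖f‖ := by
    refine ((dominated t).norm_ev_le x s).trans ?_
    have := hP.nonneg
    have := hK.nonneg s
    gcongr
    exact (mul_le_mul_of_nonneg_right (le_abs_self ω) ht.1.le).trans
      (mul_le_of_le_one_right (abs_nonneg ω) ht.2.le)
  have tendsto_integrand (s : ℝ) : Tendsto (fun t => ev x (P (t - s) (K s f))) (𝓝[>] 0) (𝓝 0) := by
    rcases le_or_gt s 0 with hs | hs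
    · simp [hK.eq_zero s hs]
    · refine tendsto_const_nhds.congr' ?_
      filter_upwards [Ioo_mem_nhdsGT hs] with t ht
      simp [hP.eq_zero (t - s) (sub_nonpos.2 ht.2.le)]
  simp only [hP.ev_convolution hK]
  rw [← integral_zero ℝ ℂ]
  exact tendsto_integral_filter_of_dominated_convergence _
    (.of_forall fun t => ((dominated t).integrable_ev x).aestronglyMeasurable)
    (eventually_of_mem (Ioo_mem_nhdsGT one_pos) fun t ht => .of_forall (norm_le ht))
    ((hK.integrable.const_mul _).mul_const _) (.of_forall tendsto_integrand)

theorem IsStrongFellerSemigroup.tendsto_ev_of_eq_add_convolution [TopologicalSpace X]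
    (hT : IsStrongFellerSemigroup T) (hP : IsExpBounded P c ω) (hK : IsExpIntegrable K ψ ω)
    (hPK : ∀ t, P t = causal T t + convolution P K t) {f : Bb X}
    (hf : Continuous fun x => ev x f) (x : X) :
    Tendsto (fun t => ev x (P t f)) (𝓝[>] 0) (𝓝 (ev x f)) := by
  have sum := (hT.tendsto_ev_zero hf x).add (hP.tendsto_convolution_nhdsGT_zero hK f x)
  rw [add_zero] at sum
  refine sum.congr' ?_
  filter_upwards [self_mem_nhdsWithin] with t ht
  rw [hPK t, _root_.add_apply, _root_.map_add, causal_of_pos T ht]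

/-- The family `(U t)_{t > 0}`, extended by the identity: it turns a family in the sense of
`IsExpBounded`, which vanishes at `0`, into a semigroup. -/
def extendById (U : ℝ → Bb X →L[ℂ] Bb X) (t : ℝ) : Bb X →L[ℂ] Bb X :=
  if 0 < t then U t else ContinuousLinearMap.id ℂ (Bb X)

theorem extendById_of_pos (U : ℝ → Bb X →L[ℂ] Bb X) {t : ℝ} (ht : 0 < t) :
    extendById U t = U t := if_pos ht

theorem extendById_zero (U : ℝ → Bb X →L[ℂ] Bb X) :
    extendById U 0 = ContinuousLinearMap.id ℂ (Bb X) := if_neg (lt_irrefl 0)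

theorem causal_extendById (hP : ∀ t ≤ 0, P t = 0) : causal (extendById P) = P := by
  ext1 t
  rcases le_or_gt t 0 with ht | ht
  · rw [causal_of_nonpos _ ht, hP t ht]
  · rw [causal_of_pos _ ht, extendById_of_pos P ht]

namespace IsExpBounded

theorem isOfType_extendById (hP : IsExpBounded P c ω) (hc : 1 ≤ c) :
    IsOfType (extendById P) c ω := by
  refine ⟨hc, fun t ht => ?_⟩
  rcases ht.eq_or_lt with rfl | ht
  · rw [extendById_zero]
    simpa using ContinuousLinearMap.norm_id_le.trans hc
  · rw [extendById_of_pos P ht]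
    exact hP.norm_le t

theorem isStrongFellerSemigroup_extendById [TopologicalSpace X] (hP : IsExpBounded P c ω)
    (hc : 1 ≤ c) (hP_add : ∀ t s, 0 < t → 0 < s → P (t + s) = (P t).comp (P s))
    (hcont : ∀ t f, Continuous fun x => ev x (P t f))
    (hlim : ∀ f, Continuous (fun x => ev x f) → ∀ x,
      Tendsto (fun t => ev x (P t f)) (𝓝[>] 0) (𝓝 (ev x f))) :
    IsStrongFellerSemigroup (extendById P) where
  sigmaContinuous t ht := by
    rw [isSigmaContinuous_iff]
    rcases ht.eq_or_lt with rfl | ht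
    · rw [extendById_zero]
      exact .id
    · rw [extendById_of_pos P ht]
      exact hP.family.kernel t
  map_zero := extendById_zero P
  map_add s t hs ht := by
    rcases hs.eq_or_lt with rfl | hs
    · rw [add_zero, extendById_zero, ContinuousLinearMap.comp_id]
    rcases ht.eq_or_lt with rfl | ht
    · rw [zero_add, extendById_zero, ContinuousLinearMap.id_comp]
    rw [extendById_of_pos P hs, extendById_of_pos P ht, extendById_of_pos P (add_pos ht hs),
      hP_add t s ht hs]
  strongFeller t ht f := by
    rw [extendById_of_pos P ht]
    exact hcont t f
  tendsto_zero f hf := by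
    refine ((hP.isOfType_extendById hc).bpTendsto_nhdsGT le_rfl fun x =>
      (hlim f hf x).congr' ?_).tendsto_sigma
    filter_upwards [self_mem_nhdsWithin] with t ht
    rw [extendById_of_pos P ht]

theorem hasWeakIntegral_convolution (hP : IsExpBounded P c ω)
    (hK : IsExpIntegrable (causal K) ψ ω) (t : ℝ) (f : Bb X) :
    HasWeakIntegral (volume.restrict (Ioc 0 t)) (fun s => extendById P (t - s) (K s f))
      (convolution P (causal K) t f) := by
  have dominated := ((hP.isDominatedFamily_convolution hK t).apply f).restrict (Ioc 0 t)
  refine (dominated.hasWeakIntegral fun x => ?_).congr_ae ?_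
  · refine (hP.ev_convolution hK t f x).trans
      (setIntegral_eq_integral_of_forall_compl_eq_zero fun s hs => ?_).symm
    rw [mem_Ioc, not_and_or, not_lt, not_le] at hs
    rcases hs with hs | hs
    · simp [hK.eq_zero s hs]
    · simp [hP.eq_zero (t - s) (sub_nonpos.2 hs.le)]
  · rw [← restrict_Ioo_eq_restrict_Ioc]
    filter_upwards [self_mem_ae_restrict measurableSet_Ioo] with s hs
    rw [causal_of_pos K hs.1, extendById_of_pos P (sub_pos.2 hs.2), ContinuousLinearMap.comp_apply]

theorem hasWeakIntegral_extendById (hT : T 0 = ContinuousLinearMap.id ℂ (Bb X))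
    (hP : IsExpBounded P c ω) (hK : IsExpIntegrable (causal K) ψ ω)
    (hPK : ∀ t, P t = causal T t + convolution P (causal K) t) {t : ℝ} (ht : 0 ≤ t) (f : Bb X) :
    HasWeakIntegral (volume.restrict (Ioc 0 t)) (fun s => extendById P (t - s) (K s f))
      (extendById P t f - T t f) := by
  convert hP.hasWeakIntegral_convolution hK t f
  rcases ht.eq_or_lt with rfl | ht
  · rw [(hP.convolution hK).eq_zero 0 le_rfl, extendById_zero, hT, sub_self, _root_.zero_apply]
  · rw [extendById_of_pos P ht, hPK t, causal_of_pos T ht, _root_.add_apply, add_sub_cancel_left]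

end IsExpBounded

end VariationOfConstants

/-! ### The perturbing operator -/

section Perturbation

variable {T P BT : ℝ → Bb X →L[ℂ] Bb X} {B : Bb X →ₗ.[ℂ] Bb X} {K : Bb X →L[ℂ] Bb X}
  {C c ω ω' : ℝ} {φ ψ : ℝ → ℝ} {z w : ℂ}

/-- `K` is the operator `B R(z)`, where `R(z)` is the resolvent of `T`, and it is a kernel
operator. -/
structure IsResolventComp (T : ℝ → Bb X →L[ℂ] Bb X) (B : Bb X →ₗ.[ℂ] Bb X) (z : ℂ)
    (K : Bb X →L[ℂ] Bb X) : Prop where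
  kernel : IsKernelOperator K
  mem_domain : ∀ f, laplace (causal T) z f ∈ B.domain
  apply_eq : ∀ f (u : B.domain), u = laplace (causal T) z f → B u = K f

/-- `BT t` is the extension of `B T(t)`, initially defined on the domain of the generator of `T`,
to a kernel operator, for all `t > 0`. -/
structure IsSemigroupComp (T : ℝ → Bb X →L[ℂ] Bb X) (B : Bb X →ₗ.[ℂ] Bb X)
    (BT : ℝ → Bb X →L[ℂ] Bb X) : Prop where
  kernel : ∀ t, 0 < t → IsKernelOperator (BT t)
  apply_eq : ∀ t, 0 < t → ∀ f ∈ domain (fullGenerator T), ∀ h : T t f ∈ B.domain,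
    B ⟨T t f, h⟩ = BT t f

variable [TopologicalSpace X]

namespace IsSemigroupComp

theorem comp_laplace (hBT : IsSemigroupComp T B BT) (hT : IsStrongFellerSemigroup T)
    (htype : IsOfType T C ω) (hz : ω < z.re) (hK : IsResolventComp T B z K) {t : ℝ}
    (ht : 0 < t) : (BT t).comp (laplace (causal T) z) = K.comp (T t) := by
  refine ContinuousLinearMap.ext fun f => ?_
  have commute : T t (laplace (causal T) z f) = laplace (causal T) z (T t f) :=
    DFunLike.congr_fun (hT.commute_laplace htype hz ht.le).eq f
  have mem : T t (laplace (causal T) z f) ∈ B.domain := commute ▸ hK.mem_domain (T t f)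
  exact (hBT.apply_eq t ht _ (hT.laplace_mem_domain htype hz f) mem).symm.trans
    (hK.apply_eq (T t f) ⟨_, mem⟩ commute)

theorem comp_laplace_causal (hBT : IsSemigroupComp T B BT) (hT : IsStrongFellerSemigroup T)
    (htype : IsOfType T C ω) (hz : ω < z.re) (hK : IsResolventComp T B z K) (t : ℝ) :
    (causal BT t).comp (laplace (causal T) z) = K.comp (causal T t) := by
  rcases le_or_gt t 0 with ht | ht
  · rw [causal_of_nonpos BT ht, causal_of_nonpos T ht, ContinuousLinearMap.zero_comp,
      ContinuousLinearMap.comp_zero]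
  · rw [causal_of_pos BT ht, causal_of_pos T ht, hBT.comp_laplace hT htype hz hK ht]

variable [HasOuterApproxClosed X] [BorelSpace X]

theorem map_add (hBT : IsSemigroupComp T B BT) (hT : IsStrongFellerSemigroup T)
    (htype : IsOfType T C ω) (hz : ω < z.re) (hK : IsResolventComp T B z K) {t s : ℝ}
    (ht : 0 < t) (hs : 0 < s) : BT (t + s) = (BT t).comp (T s) := by
  refine hT.ext_of_laplace htype hz (hBT.kernel _ (add_pos ht hs))
    ((hBT.kernel t ht).comp (hT.isKernelOperator hs.le)) ?_
  calc (BT (t + s)).comp (laplace (causal T) z)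
      = K.comp ((T t).comp (T s)) := by
        rw [hBT.comp_laplace hT htype hz hK (add_pos ht hs), hT.map_add s t hs.le ht.le]
    _ = ((BT t).comp (laplace (causal T) z)).comp (T s) := by
        rw [hBT.comp_laplace hT htype hz hK ht, ContinuousLinearMap.comp_assoc]
    _ = ((BT t).comp (T s)).comp (laplace (causal T) z) := by
        rw [ContinuousLinearMap.comp_assoc, ContinuousLinearMap.comp_assoc]
        exact congrArg _ (hT.commute_laplace htype hz hs.le).eq.symm

theorem eq_comp_sub (hBT : IsSemigroupComp T B BT) (hT : IsStrongFellerSemigroup T)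
    (htype : IsOfType T C ω) (hz : ω < z.re) (hK : IsResolventComp T B z K) {t s : ℝ}
    (ht : 0 < t) (hs : t < s) : BT s = (BT t).comp (T (s - t)) := by
  rw [← hBT.map_add hT htype hz hK ht (sub_pos.2 hs), add_sub_cancel]

theorem isKernelFamily (hBT : IsSemigroupComp T B BT) (hT : IsStrongFellerSemigroup T)
    (htype : IsOfType T C ω) (hz : ω < z.re) (hK : IsResolventComp T B z K) :
    IsKernelFamily (causal BT) := by
  refine isKernelFamily_causal_of_tendsto_nhdsGT hBT.kernel fun t ht f x => ?_
  have split {s : ℝ} (hs : t ≤ s) : BT s = (BT (t / 2)).comp (T (s - t / 2)) :=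
    hBT.eq_comp_sub hT htype hz hK (half_pos ht) ((half_lt_self ht).trans_le hs)
  have sub_half_pos : 0 < t - t / 2 := sub_pos.2 (half_lt_self ht)
  have bpTendsto := (htype.bpTendsto_nhdsGT sub_half_pos.le
    (hT.tendsto_ev_nhdsGT sub_half_pos f)).comp (tendsto_sub_const_nhdsGT (t / 2) t)
  rw [split le_rfl]
  refine ((hBT.kernel _ (half_pos ht) x).tendsto bpTendsto).congr' ?_
  filter_upwards [self_mem_nhdsWithin] with s hs
  rw [split (le_of_lt hs)]
  rfl

theorem norm_le (hBT : IsSemigroupComp T B BT) (hT : IsStrongFellerSemigroup T)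
    (htype : IsOfType T C ω) (hz : ω < z.re) (hK : IsResolventComp T B z K) {s : ℝ}
    (hs : 1 < s) : ‖BT s‖ ≤ ‖BT 1‖ * C * Real.exp (-ω) * Real.exp (ω * s) := by
  calc ‖BT s‖ ≤ ‖BT 1‖ * ‖T (s - 1)‖ := by
        rw [hBT.eq_comp_sub hT htype hz hK one_pos hs]
        exact ContinuousLinearMap.opNorm_comp_le _ _
    _ ≤ ‖BT 1‖ * (C * Real.exp (ω * (s - 1))) := by
        gcongr
        exact htype.2 _ (sub_pos.2 hs).le
    _ = ‖BT 1‖ * C * Real.exp (-ω) * Real.exp (ω * s) := by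
        rw [mul_assoc _ (Real.exp (-ω)), ← Real.exp_add]
        ring_nf

theorem exists_isExpIntegrable (hBT : IsSemigroupComp T B BT) (hT : IsStrongFellerSemigroup T)
    (htype : IsOfType T C ω) (hz : ω < z.re) (hK : IsResolventComp T B z K)
    (hφ : IntegrableOn φ (Ioc 0 1)) (hBTφ : ∀ s, 0 < s → ‖BT s‖ ≤ φ s) :
    ∃ ψ ω', ω < ω' ∧ IsExpIntegrable (causal BT) ψ ω' ∧ ∫ s, ψ s < 1 := by
  obtain ⟨ψ₀, hψ₀⟩ := (hBT.isKernelFamily hT htype hz hK).exists_isExpIntegrable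
    (fun t ht => causal_of_nonpos BT ht) hφ
    (fun t ht => by rw [causal_of_pos BT ht.1]; exact hBTφ t ht.1)
    (fun t ht => by rw [causal_of_pos BT (one_pos.trans ht)]; exact hBT.norm_le hT htype hz hK ht)
    (lt_add_one ω)
  obtain ⟨ψ, ω', hω', hψ, hψ_lt⟩ := hψ₀.exists_integral_lt_one
  exact ⟨ψ, ω', (lt_add_one ω).trans_le hω', hψ, hψ_lt⟩

theorem isResolventComp_laplace (hBT : IsSemigroupComp T B BT) (hT : IsStrongFellerSemigroup T)
    (htype : IsOfType T C ω) (hz : ω < z.re) (hK : IsResolventComp T B z K) (hw : ω < w.re)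
    (hψ : IsExpIntegrable (causal BT) ψ ω') (hω' : ω' ≤ w.re) :
    IsResolventComp T B w (laplace (causal BT) w) := by
  have integrable := hT.isExpIntegrable htype hw
  let A : Bb X →L[ℂ] Bb X := .id ℂ (Bb X) - (w - z) • laplace (causal T) w
  have laplace_eq : laplace (causal T) w = (laplace (causal T) z).comp A := by
    rw [ContinuousLinearMap.comp_sub, ContinuousLinearMap.comp_id, ContinuousLinearMap.comp_smul,
      ← neg_sub z w, neg_smul, hT.resolvent_identity htype hz hw, sub_neg_eq_add, add_sub_cancel]
  have commute : Commute A (laplace (causal T) z) :=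
    (Commute.one_left _).sub_left ((hT.laplace_commute_laplace htype hw hz).smul_left _)
  have comp_eq : A.comp (laplace (causal T) z) = laplace (causal T) w :=
    commute.eq.trans laplace_eq.symm
  have laplace_BT : K.comp A = laplace (causal BT) w := by
    refine hT.ext_of_laplace htype hz
      (hK.kernel.comp (.sub .id ((integrable.isKernelOperator_laplace le_rfl).smul _)))
      (hψ.isKernelOperator_laplace hω') ?_
    rw [ContinuousLinearMap.comp_assoc, comp_eq, integrable.comp_laplace le_rfl hK.kernel,
      hψ.laplace_comp hω']
    simp only [hBT.comp_laplace_causal hT htype hz hK]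
  refine ⟨hψ.isKernelOperator_laplace hω', fun f => ?_, fun f u hu => ?_⟩
  · rw [laplace_eq]
    exact hK.mem_domain (A f)
  · rw [← laplace_BT]
    exact hK.apply_eq (A f) u (hu.trans (DFunLike.congr_fun laplace_eq f))

end IsSemigroupComp

/-! ### The generator of the perturbed semigroup -/

theorem exists_sub_apply_eq {E : Type*} [NormedAddCommGroup E] [NormedSpace ℂ E] [CompleteSpace E]
    {A : E →L[ℂ] E} (hA : ‖A‖ < 1) (k : E) : ∃ h, h - A h = k := by
  obtain ⟨u, hu⟩ := isUnit_one_sub_of_norm_lt_one hA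
  refine ⟨(↑u⁻¹ : E →L[ℂ] E) k, ?_⟩
  have mul_inv : (1 - A) * (↑u⁻¹ : E →L[ℂ] E) = 1 := hu ▸ u.mul_inv
  exact DFunLike.congr_fun mul_inv k

namespace IsResolventComp

theorem mem_addOperator_iff (hK : IsResolventComp T B z K) (hT : IsStrongFellerSemigroup T)
    (htype : IsOfType T C ω) (hz : ω < z.re) {f g : Bb X} :
    (f, g) ∈ addOperator (fullGenerator T) B ↔
      ∃ h, laplace (causal T) z h = f ∧ h - K h = z • f - g := by
  constructor
  · rintro ⟨g', hg', hf, hg⟩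
    have laplace_eq := (hT.mem_fullGenerator_iff htype hz).1 hg'
    refine ⟨z • f - g', laplace_eq, ?_⟩
    rw [← hK.apply_eq _ ⟨f, hf⟩ laplace_eq.symm, sub_sub]
    exact congrArg _ hg.symm
  · rintro ⟨h, hf, hg⟩
    have mem : f ∈ B.domain := hf ▸ hK.mem_domain h
    refine ⟨z • f - h, (hT.mem_fullGenerator_iff htype hz).2 (by rw [sub_sub_cancel, hf]), mem, ?_⟩
    rw [hK.apply_eq h ⟨f, mem⟩ hf.symm, sub_add, hg, sub_sub_cancel]

theorem fullGenerator_eq_addOperator (hK : IsResolventComp T B z K) (hK_norm : ‖K‖ < 1)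
    (hT : IsStrongFellerSemigroup T) (htype : IsOfType T C ω) (hz : ω < z.re)
    (hP : IsStrongFellerSemigroup P) (htypeP : IsOfType P c ω') (hz' : ω' < z.re)
    (hPK : laplace (causal P) z = laplace (causal T) z + (laplace (causal P) z).comp K) :
    fullGenerator P = addOperator (fullGenerator T) B := by
  have laplace_sub (h : Bb X) : laplace (causal P) z (h - K h) = laplace (causal T) z h := by
    rw [_root_.map_sub, sub_eq_iff_eq_add]
    exact DFunLike.congr_fun hPK h
  ext ⟨f, g⟩
  rw [hP.mem_fullGenerator_iff htypeP hz', hK.mem_addOperator_iff hT htype hz]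
  constructor
  · intro hf
    obtain ⟨h, hh⟩ := exists_sub_apply_eq hK_norm (z • f - g)
    exact ⟨h, by rw [← laplace_sub, hh, hf], hh⟩
  · rintro ⟨h, hf, hh⟩
    rw [← hh, laplace_sub, hf]

end IsResolventComp

/-- The semigroup given at `t > 0` by the Dyson–Phillips series of `T` with respect to
`BT t = B T(t)`. -/
def perturbedSemigroup (T BT : ℝ → Bb X →L[ℂ] Bb X) : ℝ → Bb X →L[ℂ] Bb X :=
  extendById (dysonPhillips (causal T) (causal BT))

namespace IsStrongFellerSemigroup

theorem isOfType_perturbedSemigroup (hT : IsStrongFellerSemigroup T) (htype : IsOfType T C ω')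
    (hψ : IsExpIntegrable (causal BT) ψ ω') (hψ_lt : ∫ s, ψ s < 1) :
    IsOfType (perturbedSemigroup T BT) (C * (1 - ∫ s, ψ s)⁻¹) ω' :=
  (isExpBounded_dysonPhillips (hT.isExpBounded htype) hψ hψ_lt).isOfType_extendById <|
    one_le_mul_of_one_le_of_one_le htype.1 <|
      (one_le_inv₀ (sub_pos.2 hψ_lt)).2 (sub_le_self 1 hψ.integral_nonneg)

theorem isStrongFellerSemigroup_perturbedSemigroup [FirstCountableTopology X]
    (hT : IsStrongFellerSemigroup T) (htype : IsOfType T C ω')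
    (hψ : IsExpIntegrable (causal BT) ψ ω') (hψ_lt : ∫ s, ψ s < 1)
    (hBT_add : ∀ t s, 0 < t → 0 < s → BT (t + s) = (BT t).comp (T s)) :
    IsStrongFellerSemigroup (perturbedSemigroup T BT) := by
  have hT' := hT.isExpBounded htype
  have hP := isExpBounded_dysonPhillips hT' hψ hψ_lt
  have duhamel := dysonPhillips_eq hT' hψ hψ_lt
  have hT_add := causal_add fun t s ht hs => hT.map_add s t hs.le ht.le
  exact hP.isStrongFellerSemigroup_extendById
    (hT.isOfType_perturbedSemigroup htype hψ hψ_lt).1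
    (fun t s => hP.comp_of_eq_add_convolution hψ hψ_lt duhamel hT_add (causal_add hBT_add))
    (continuous_dysonPhillips hT' hψ hψ_lt hT.continuous_ev_causal)
    fun f hf => hT.tendsto_ev_of_eq_add_convolution hP hψ duhamel hf

theorem hasWeakIntegral_perturbedSemigroup (hT : IsStrongFellerSemigroup T)
    (htype : IsOfType T C ω') (hψ : IsExpIntegrable (causal BT) ψ ω') (hψ_lt : ∫ s, ψ s < 1)
    {t : ℝ} (ht : 0 ≤ t) (f : Bb X) :
    HasWeakIntegral (volume.restrict (Ioc 0 t))
      (fun s => perturbedSemigroup T BT (t - s) (BT s f))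
      (perturbedSemigroup T BT t f - T t f) :=
  (isExpBounded_dysonPhillips (hT.isExpBounded htype) hψ hψ_lt).hasWeakIntegral_extendById
    hT.map_zero hψ (dysonPhillips_eq (hT.isExpBounded htype) hψ hψ_lt) ht f

theorem laplace_perturbedSemigroup (hT : IsStrongFellerSemigroup T)
    (htype : IsOfType T C ω') (hψ : IsExpIntegrable (causal BT) ψ ω') (hψ_lt : ∫ s, ψ s < 1)
    (hz : ω' < z.re) :
    laplace (causal (perturbedSemigroup T BT)) z = laplace (causal T) z +
      (laplace (causal (perturbedSemigroup T BT)) z).comp (laplace (causal BT) z) := by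
  have hT' := hT.isExpBounded htype
  have hP := isExpBounded_dysonPhillips hT' hψ hψ_lt
  rw [perturbedSemigroup, causal_extendById hP.eq_zero]
  exact hT'.laplace_eq_of_eq_add_convolution hP hψ (dysonPhillips_eq hT' hψ hψ_lt) hz

end IsStrongFellerSemigroup

end Perturbation

end StrongFellerPerturbation

end

theorem theorem3p3_general {M : Type*} [TopologicalSpace M] [FirstCountableTopology M]
    [HasOuterApproxClosed M] [MeasurableSpace M] [BorelSpace M]
    (T : ℝ → (Bb M →L[ℂ] Bb M)) (hT : IsStrongFellerSemigroup T)
    (C ω : ℝ) (htype : IsOfType T C ω)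
    (B : Bb M →ₗ.[ℂ] Bb M)
    (hdom : domain (fullGenerator T) ⊆ (B.domain : Set (Bb M)))
    (hBR : ∃ z : ℂ, ω < z.re ∧ ∃ K : Bb M →L[ℂ] Bb M, IsSigmaContinuous K ∧
      ∀ f u : Bb M, IsLaplaceTransform T z f u → ∀ hu : u ∈ B.domain, B ⟨u, hu⟩ = K f)
    (BT : ℝ → (Bb M →L[ℂ] Bb M))
    (hBT : ∀ t, 0 < t → IsSigmaContinuous (BT t))
    (hBT_eq : ∀ t, 0 < t → ∀ f ∈ domain (fullGenerator T), ∀ h : T t f ∈ B.domain,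
      B ⟨T t f, h⟩ = BT t f)
    (φ : ℝ → ℝ) (hφ : LocallyIntegrableOn φ (Ici 0) volume)
    (hbound : ∀ s, 0 < s → ‖BT s‖ ≤ φ s) :
    ∃ P : ℝ → (Bb M →L[ℂ] Bb M), IsStrongFellerSemigroup P ∧
      fullGenerator P = addOperator (fullGenerator T) B ∧
      ∀ (t : ℝ), 0 ≤ t → ∀ f : Bb M,
        HasWeakIntegral (volume.restrict (Ioc 0 t)) (fun s => P (t - s) (BT s f))
          (P t f - T t f) := by
  obtain ⟨z, hz, K, hK, hBK⟩ := hBR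
  have resolventComp : IsResolventComp T B z K :=
    ⟨isSigmaContinuous_iff.1 hK, fun f => hdom (hT.laplace_mem_domain htype hz f),
      fun f u hu => hBK f u ((hT.isLaplaceTransform_iff htype hz).2 hu.symm) u.2⟩
  have semigroupComp : IsSemigroupComp T B BT :=
    ⟨fun t ht => isSigmaContinuous_iff.1 (hBT t ht), hBT_eq⟩
  obtain ⟨ψ, ω', hω, hψ, hψ_lt⟩ := semigroupComp.exists_isExpIntegrable hT htype hz resolventComp
    ((hφ.integrableOn_compact_subset Icc_subset_Ici_self isCompact_Icc).mono_set
      Ioc_subset_Icc_self) hbound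
  have htype' := htype.mono hω.le
  have perturbed := hT.isStrongFellerSemigroup_perturbedSemigroup htype' hψ hψ_lt fun t s =>
    semigroupComp.map_add hT htype hz resolventComp
  refine ⟨_, perturbed, ?_, fun t => hT.hasWeakIntegral_perturbedSemigroup htype' hψ hψ_lt⟩
  obtain ⟨r, hr⟩ := exists_gt ω'
  replace hr : ω' < (r : ℂ).re := hr
  have resolventComp' :=
    semigroupComp.isResolventComp_laplace hT htype hz resolventComp (hω.trans hr) hψ hr.le
  exact resolventComp'.fullGenerator_eq_addOperator ((hψ.norm_laplace_le hr.le).trans_lt hψ_lt)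
    hT htype' hr perturbed (hT.isOfType_perturbedSemigroup htype' hψ hψ_lt) hr
    (hT.laplace_perturbedSemigroup htype' hψ hψ_lt hr)

theorem theorem3p3 {M : Type*} [MetricSpace M] [CompleteSpace M] [TopologicalSpace.SeparableSpace M]
    [MeasurableSpace M] [BorelSpace M]
    -- a strong Feller semigroup of type `(C, ω)`
    (T : ℝ → (Bb M →L[ℂ] Bb M)) (hT : IsStrongFellerSemigroup T)
    (C ω : ℝ) (htype : IsOfType T C ω)
    -- a linear operator `B : D(B) → B_b(M)` with `D(𝓛) ⊆ D(B)`
    (B : Bb M →ₗ.[ℂ] Bb M)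
    (hdom : domain (fullGenerator T) ⊆ (B.domain : Set (Bb M)))
    -- `B 𝓡(z)` is `σ`-continuous for one `z` with `Re z > ω`
    (hBR : ∃ z : ℂ, ω < z.re ∧ ∃ K : Bb M →L[ℂ] Bb M, IsSigmaContinuous K ∧
      ∀ f u : Bb M, IsLaplaceTransform T z f u → ∀ hu : u ∈ B.domain, B ⟨u, hu⟩ = K f)
    -- `BT t` is the `σ`-continuous extension of `B T(t)`, initially defined on `D(𝓛)`, for `t > 0`
    (BT : ℝ → (Bb M →L[ℂ] Bb M))
    (hBT : ∀ t, 0 < t → IsSigmaContinuous (BT t))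
    (hBT_eq : ∀ t, 0 < t → ∀ f ∈ domain (fullGenerator T), ∀ h : T t f ∈ B.domain,
      B ⟨T t f, h⟩ = BT t f)
    -- scalar measurability on `(0, ∞)`
    (hmeas : ∀ (f : Bb M) (μ : ComplexMeasure M),
      Measurable (fun s : Ioi (0 : ℝ) => dual (BT s f) μ))
    -- the bound by a function in `L¹_loc([0, ∞))`
    (φ : ℝ → ℝ) (hφ : LocallyIntegrableOn φ (Ici 0) volume)
    (hbound : ∀ s, 0 < s → ‖BT s‖ ≤ φ s) :
    ∃ P : ℝ → (Bb M →L[ℂ] Bb M), IsStrongFellerSemigroup P ∧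
      fullGenerator P = addOperator (fullGenerator T) B ∧
      ∀ (t : ℝ), 0 ≤ t → ∀ f : Bb M,
        HasWeakIntegral (volume.restrict (Ioc 0 t)) (fun s => P (t - s) (BT s f))
          (P t f - T t f) :=
  theorem3p3_general T hT C ω htype B hdom hBR BT hBT hBT_eq φ hφ hbound
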